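/- Click-through-rate model. There are finitely many clients $i$ and webpage slots $s$, and countably many keywords $q$. For each $q$ let $\mathcal M_q$ be a nonempty set of $0$-$1$ matrices $M=(M_{is})$ with at most one $1$ in every row and in every column (the admissible assignments of clients to slots), and let $c_{qis}\in[0,1]$ be click-through rates. In each time slot $t=0,1,2,\dots$ a query for keyword $q$ arrives with probability $\nu_q=\nu\vartheta_q$, where $\nu\in(0,1)$, $\vartheta_q\ge 0$, $\sum_q\vartheta_q=1$, and no query arrives with probability $1-\nu$; the outcomes $\tilde q(t)$ are i.i.d. over time slots. A requirement cycle consists of $N\ge1$ time slots, and client $i$ requires $m_i\ge0$ impressions per cycle on average. Let $\tilde m(k)=(\tilde m_i(k))_i$, $k\ge0$, be i.i.d. random vectors, independent of the queries, with $\tilde m_i(k)=\lceil m_i\rceil$ with probability $m_i-\lfloor m_i\rfloor$ and $\tilde m_i(k)=\lfloor m_i\rfloor$ otherwise. Fix $\epsilon>0$. Online algorithm. The initial credit queue vector $\mathbf Q(0)$ has nonnegative integer entries and is independent of all $\tilde q(t)$ and $\tilde m(k)$. In cycle $k$, every query for a keyword $q$ is answered with a matrix $$\tilde M^*(q,\mathbf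 Q(k))\in\arg\max_{M\in\mathcal M_q}\sum_{i,s}M_{is}\Big(\frac{c_{qis}}{\epsilon}+Q_i(k)\Big),$$ ties being broken by an arbitrary fixed function of $(q,\mathbf Q(k))$. Let $S_i(k)=\sum_{t=kN}^{kN+N-1}\sum_s[\tilde M^*(\tilde q(t),\mathbf Q(k))]_{is}$, with the convention that a time slot without a query contributes $0$, be the number of impressions of client $i$ in cycle $k$, and let $Q_i(k+1)=\max\{Q_i(k)+\tilde m_i(k)-S_i(k),\,0\}$. The Markov chain $\{\mathbf Q(k)\}$ is called stable (positive recurrent) if there is a finite set $B$ of states such that, from every deterministic initial state, the expected value of the first $k\ge1$ with $\mathbf Q(k)\in B$ is finite. Statement. (a) The credit queues are stable whenever there are numbers $p_{qM}\in[0,1]$ ($M\in\mathcal M_q$) with $\sum_{M\in\mathcal M_q}p_{qM}\le1$ for all $q$ and $$N\sum_q\nu_q\sum_{M\in\mathcal M_q}p_{qM}\sum_sM_{is}>m_i\quad\text{for all } i.$$ (b) If the credit queues are stable, then for every client $i$ the following limit exists and satisfies $$\lim_{K\to\infty}E\Big[\frac1K\sum_{k=1}^{K}S_i(k)\Big]\ge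 m_i .$$ In particular, under the condition in (a), the long-run expected average number of impressions of each client per requirement cycle is at least its requirement. -/

import Mathlib

open MeasureTheory ProbabilityTheory Filter Topology
open scoped ENNReal

/-- The outcome of a time slot is `some κ` (a query for keyword `κ`) or `none` (no query); it is a
discrete random variable, so every set of outcomes is measurable. -/
instance optionMeasurableSpace {Kw : Type*} : MeasurableSpace (Option Kw) := ⊤

/-- A 0-1 matrix assigning clients (rows) to webpage slots (columns): every slot is given to at most
one client and every client gets at most one slot. -/
def IsAssignment {ι σ : Type*} [Fintype ι] [Fintype σ] (M : Matrix ι σ ℕ) : Prop :=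
  (∀ i s, M i s = 0 ∨ M i s = 1) ∧ (∀ s, ∑ i, M i s ≤ 1) ∧ (∀ i, ∑ s, M i s ≤ 1)

/-- The parameters of the click-through-rate maximization model, with clients `ι`, webpage slots `σ`
and keywords `Kw`. -/
structure CTRModel (ι σ Kw : Type*) [Fintype ι] [Fintype σ] where
  /-- the admissible assignment matrices for each keyword -/
  admissible : Kw → Finset (Matrix ι σ ℕ)
  admissible_isAssignment : ∀ κ, ∀ M ∈ admissible κ, IsAssignment M
  /-- the click-through rates -/
  c : Kw → ι → σ → ℝ
  c_nonneg : ∀ κ i s, 0 ≤ c κ i s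
  c_le_one : ∀ κ i s, c κ i s ≤ 1
  /-- the probability that a query arrives in a time slot -/
  arrival : ℝ
  arrival_pos : 0 < arrival
  arrival_lt_one : arrival < 1
  /-- the distribution of the keyword of an arriving query -/
  θ : Kw → ℝ
  θ_nonneg : ∀ κ, 0 ≤ θ κ
  θ_hasSum : HasSum θ 1
  /-- the number of time slots in a requirement cycle -/
  N : ℕ
  N_pos : 0 < N
  /-- the average impression requirement of each client per requirement cycle -/
  m : ι → ℝ
  m_nonneg : ∀ i, 0 ≤ m i
  /-- the parameter of the online algorithm -/
  ε : ℝ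
  ε_pos : 0 < ε

namespace CTRModel

variable {ι σ Kw Ω : Type*} [Fintype ι] [Fintype σ] [MeasurableSpace Ω]

/-- The rate of queries for keyword `κ` per time slot. -/
def rate (A : CTRModel ι σ Kw) (κ : Kw) : ℝ := A.arrival * A.θ κ

/-- The average number of impressions of client `i` per requirement cycle when each query for `κ` is
answered by the matrix `M` with probability `p κ M`. -/
noncomputable def avgImpressions (A : CTRModel ι σ Kw) (p : Kw → Matrix ι σ ℕ → ℝ) (i : ι) : ℝ :=
  A.N * ∑' κ, A.rate κ * ∑ M ∈ A.admissible κ, p κ M * ∑ s, (M i s : ℝ)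

/-- `p` is a (sub)probability choice of admissible matrices that gives each client strictly more
impressions per requirement cycle, on average, than it requires. -/
def StrictlyFeasible (A : CTRModel ι σ Kw) (p : Kw → Matrix ι σ ℕ → ℝ) : Prop :=
  (∀ κ, ∀ M ∈ A.admissible κ, 0 ≤ p κ M ∧ p κ M ≤ 1) ∧
  (∀ κ, ∑ M ∈ A.admissible κ, p κ M ≤ 1) ∧
  ∀ i, A.m i < A.avgImpressions p i

/-- The statistical assumptions on the query process `q` (indexed by time slots) and on the integer
requirements `mt` (indexed by requirement cycles): the queries are i.i.d. over time slots; the vectors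
`mt k` are i.i.d. over cycles and independent of the queries; `mt k i` equals `⌈m i⌉` with
probability `m i - ⌊m i⌋` and `⌊m i⌋` otherwise. -/
structure IsInput (A : CTRModel ι σ Kw) (μ : Measure Ω) (q : ℕ → Ω → Option Kw)
    (mt : ℕ → Ω → ι → ℕ) : Prop where
  measurable_q : ∀ t, Measurable (q t)
  prob_some : ∀ t κ, μ {ω | q t ω = some κ} = ENNReal.ofReal (A.rate κ)
  prob_none : ∀ t, μ {ω | q t ω = none} = ENNReal.ofReal (1 - A.arrival)
  indep_q : iIndepFun q μ
  measurable_mt : ∀ k, Measurable (mt k)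
  law_mt : ∀ k i, μ.map (fun ω => mt k ω i) =
    ENNReal.ofReal (A.m i - ⌊A.m i⌋₊) • Measure.dirac ⌈A.m i⌉₊ +
      ENNReal.ofReal (1 - (A.m i - ⌊A.m i⌋₊)) • Measure.dirac ⌊A.m i⌋₊
  identDistrib_mt : ∀ k, IdentDistrib (mt k) (mt 0) μ μ
  indep_mt : iIndepFun mt μ
  indep_q_mt : IndepFun (fun ω t => q t ω) (fun ω k => mt k ω) μ

/-- The objective of the maximization step of the online algorithm, for a query for `κ` when the
queue lengths are `Q`. -/
noncomputable def weight (A : CTRModel ι σ Kw) (κ : Kw) (Q : ι → ℕ) (M : Matrix ι σ ℕ) : ℝ :=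
  ∑ i, ∑ s, (M i s : ℝ) * (A.c κ i s / A.ε + Q i)

/-- `sel κ Q` is, for all `κ` and `Q`, one of the admissible matrices of maximal weight: `sel` is a
way to run the online algorithm, with ties broken in an arbitrary fixed manner. -/
def IsMaxWeightRule (A : CTRModel ι σ Kw) (sel : Kw → (ι → ℕ) → Matrix ι σ ℕ) : Prop :=
  ∀ κ Q, sel κ Q ∈ A.admissible κ ∧ ∀ M ∈ A.admissible κ, A.weight κ Q M ≤ A.weight κ Q (sel κ Q)

/-- The number of impressions of client `i` during requirement cycle `k`, along the query sequence
`q`, if the queue lengths at the beginning of the cycle are `Q`. -/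
def impressions (A : CTRModel ι σ Kw) (sel : Kw → (ι → ℕ) → Matrix ι σ ℕ) (q : ℕ → Option Kw)
    (k : ℕ) (Q : ι → ℕ) (i : ι) : ℕ :=
  ∑ t ∈ Finset.Ico (k * A.N) (k * A.N + A.N),
    match q t with
    | none => 0
    | some κ => ∑ s, sel κ Q i s

/-- The credit queues at the beginning of requirement cycle `k`, started from `Q₀`. Subtraction of
natural numbers is truncated at `0`, so the update is `[Q i + mt i - S i]⁺`. -/
def queue (A : CTRModel ι σ Kw) (sel : Kw → (ι → ℕ) → Matrix ι σ ℕ) (q : ℕ → Option Kw)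
    (mt : ℕ → ι → ℕ) (Q₀ : ι → ℕ) : ℕ → ι → ℕ
  | 0 => Q₀
  | k + 1 => fun i =>
      queue A sel q mt Q₀ k i + mt k i - A.impressions sel q k (queue A sel q mt Q₀ k) i

/-- The first `k ≥ 1` at which the queue vector started from `Q₀` is in `B` (`∞` if there is none). -/
noncomputable def returnTime (A : CTRModel ι σ Kw) (sel : Kw → (ι → ℕ) → Matrix ι σ ℕ)
    (q : ℕ → Option Kw) (mt : ℕ → ι → ℕ) (Q₀ : ι → ℕ) (B : Finset (ι → ℕ)) : ℝ≥0∞ :=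
  ⨅ (k : ℕ) (_ : 1 ≤ k) (_ : A.queue sel q mt Q₀ k ∈ B), (k : ℝ≥0∞)

/-- Stability (positive recurrence) of the Markov chain of credit queues: there is a finite set of
states that the chain, from every initial state, reaches (or returns to) in finite expected time. For
an irreducible chain this is positive recurrence of every state. -/
def Stable (A : CTRModel ι σ Kw) (μ : Measure Ω) (sel : Kw → (ι → ℕ) → Matrix ι σ ℕ)
    (q : ℕ → Ω → Option Kw) (mt : ℕ → Ω → ι → ℕ) : Prop :=
  ∃ B : Finset (ι → ℕ), ∀ x : ι → ℕ,
    ∫⁻ ω, A.returnTime sel (fun t => q t ω) (fun k => mt k ω) x B ∂μ < ∞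

/-- The number of impressions of client `i` in requirement cycle `k` when the online algorithm is run
from the (random) initial queue lengths `Q₀`. -/
def cycleImpressions (A : CTRModel ι σ Kw) (sel : Kw → (ι → ℕ) → Matrix ι σ ℕ)
    (q : ℕ → Ω → Option Kw) (mt : ℕ → Ω → ι → ℕ) (Q₀ : Ω → ι → ℕ) (k : ℕ) (i : ι) (ω : Ω) : ℕ :=
  A.impressions sel (fun t => q t ω) k
    (A.queue sel (fun t => q t ω) (fun j => mt j ω) (Q₀ ω) k) i

end CTRModel

/-! Part (a) is a Foster–Lyapunov argument with the quadratic function of the queue lengths. In one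
cycle its expected increment is at most a constant plus `2 ∑ x i * (m i - meanImpressions i)`. The
click term of the weight lies between `0` and `card ι / ε`, so up to a constant the maximum weight
rule does at least as well in queue-weighted impressions as any feasible `p`. Strict feasibility
thus makes the drift at most `-1` outside a finite box (`IsInput.stable_of_strictlyFeasible`, via
`tsum_tabooOp_iterate_ne_top`).

For (b), finite expected hitting times of a finite set make the laws of the queues tight, for any
initial law: a last-exit decomposition bounds the mass far out by a sum dominated by the expected
return times from that set (`exists_finset_law_compl_le`). Tightness gives both claims. The limit
exists by a mean ergodic theorem (`exists_tendsto_average_integral`), which compares averaged laws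
by compactness and needs neither irreducibility nor aperiodicity. The lower bound comes from
telescoping the expectation of the queue capped at `R`: its increment is at least requirement minus
impressions, except on the rare event that the queue is outside a large finite set
(`IsInput.exists_le_average_impressions`). The cap matters because the uncapped queue need not have
a finite mean.

The link to the model is that the queue is a recursion driven by i.i.d. cycle noise independent of
the past, so that stability becomes a statement about one kernel (`IsInput.stable_iff`). -/

/-! ### Averages of shifted bounded sequences -/

/-- Shifting a bounded sequence by `j` changes its averages of length `K` by at most `2 M j / K`. -/
lemma abs_average_shift_sub_average_le {a : ℕ → ℝ} {M : ℝ} (ha : ∀ k, |a k| ≤ M) (j K : ℕ) :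
    |(∑ k ∈ Finset.range K, a (j + k)) / K - (∑ k ∈ Finset.range K, a k) / K| ≤ 2 * M * j / K := by
  have key : |∑ k ∈ Finset.range K, a (j + k) - ∑ k ∈ Finset.range K, a k| ≤ 2 * M * j := by
    induction j with
    | zero => simp
    | succ j ih =>
      have h1 : ∑ k ∈ Finset.range K, a (j + 1 + k) + a j
          = ∑ k ∈ Finset.range K, a (j + k) + a (j + K) := by
        rw [← Finset.sum_range_succ (fun k => a (j + k)), Finset.sum_range_succ']
        simp only [add_zero]
        congr 1
        exact Finset.sum_congr rfl fun k _ => by congr 1; ring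
      have h2 := abs_le.1 (ha j)
      have h3 := abs_le.1 (ha (j + K))
      have h4 := abs_le.1 ih
      rw [abs_le]
      push_cast
      constructor <;> linarith
  rw [← sub_div, abs_div, Nat.abs_cast]
  gcongr

/-- The double averages of the array `a (j + k)` are close to the simple averages of `a`. -/
lemma abs_average_average_sub_average_le {a : ℕ → ℝ} {M : ℝ} (ha : ∀ k, |a k| ≤ M) {J : ℕ}
    (hJ : 0 < J) (K : ℕ) :
    |(∑ j ∈ Finset.range J, (∑ k ∈ Finset.range K, a (j + k)) / K) / J
      - (∑ k ∈ Finset.range K, a k) / K| ≤ 2 * M * J / K := by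
  have hM : 0 ≤ M := (abs_nonneg _).trans (ha 0)
  have hJ' : (0 : ℝ) < J := by exact_mod_cast hJ
  set c := (∑ k ∈ Finset.range K, a k) / K
  have h : (∑ j ∈ Finset.range J, (∑ k ∈ Finset.range K, a (j + k)) / K) / J - c
      = (∑ j ∈ Finset.range J, ((∑ k ∈ Finset.range K, a (j + k)) / K - c)) / J := by
    rw [Finset.sum_sub_distrib, Finset.sum_const, Finset.card_range, nsmul_eq_mul]
    field_simp
  rw [h, abs_div, Nat.abs_cast, div_le_iff₀ hJ']
  calc |∑ j ∈ Finset.range J, ((∑ k ∈ Finset.range K, a (j + k)) / K - c)|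
      ≤ ∑ j ∈ Finset.range J, |(∑ k ∈ Finset.range K, a (j + k)) / K - c| :=
        Finset.abs_sum_le_sum_abs _ _
    _ ≤ ∑ j ∈ Finset.range J, 2 * M * J / K := by
        refine Finset.sum_le_sum fun j hj => (abs_average_shift_sub_average_le ha j K).trans ?_
        have : (j : ℝ) ≤ J := by exact_mod_cast (Finset.mem_range.1 hj).le
        gcongr
    _ = 2 * M * J / K * J := by
        rw [Finset.sum_const, Finset.card_range, nsmul_eq_mul, mul_comm]

lemma average_average_comm (a : ℕ → ℝ) (J K : ℕ) :
    (∑ j ∈ Finset.range J, (∑ k ∈ Finset.range K, a (j + k)) / K) / J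
      = (∑ k ∈ Finset.range K, (∑ j ∈ Finset.range J, a (k + j)) / J) / K := by
  rw [← Finset.sum_div, ← Finset.sum_div, Finset.sum_comm, div_div, div_div, mul_comm]
  simp only [add_comm]

/-! ### Mean ergodic theorem for tight chains -/

section Markov

variable {X : Type*} [MeasurableSpace X]

lemma abs_integral_le_of_abs_le (ν : Measure X) [IsProbabilityMeasure ν] {f : X → ℝ} {M : ℝ}
    (hf : ∀ x, |f x| ≤ M) : |∫ x, f x ∂ν| ≤ M := by
  rw [← Real.norm_eq_abs]
  exact (norm_integral_le_of_norm_le_const (ae_of_all ν hf)).trans (by simp)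

variable [DiscreteMeasurableSpace X]

lemma integrable_of_abs_le (ν : Measure X) [IsFiniteMeasure ν] {f : X → ℝ} {M : ℝ}
    (hf : ∀ x, |f x| ≤ M) : Integrable f ν :=
  Integrable.of_bound (Measurable.of_discrete).aestronglyMeasurable M (ae_of_all _ hf)

lemma integral_bind_of_abs_le (κ : Kernel X X) [IsMarkovKernel κ] (ν : Measure X)
    [IsProbabilityMeasure ν] {f : X → ℝ} {M : ℝ} (hf : ∀ x, |f x| ≤ M) :
    ∫ x, f x ∂(ν.bind κ) = ∫ x, ∫ y, f y ∂κ x ∂ν := by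
  have h : (κ ∘ₖ Kernel.const Unit ν) () = ν.bind κ := rfl
  rw [← h, Kernel.integral_comp]
  · rfl
  · exact integrable_of_abs_le _ hf

variable [Countable X]

/-- Two finite families of probability measures whose averages give almost the same mass to the
points of a finite set `F`, and little mass to the complement of `F`, give almost the same average
to bounded functions. -/
lemma abs_average_integral_sub_le {law : ℕ → Measure X} [∀ k, IsProbabilityMeasure (law k)]
    {F : Finset X} {η : ℝ} (hF : ∀ k, (law k).real (F : Set X)ᶜ ≤ η) {f : X → ℝ} {M : ℝ}
    (hf : ∀ x, |f x| ≤ M) (hM : 0 ≤ M) {J J' : ℕ} (hJ : 0 < J) (hJ' : 0 < J')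
    (hclose : ∑ y ∈ F, |(∑ j ∈ Finset.range J, (law j).real {y}) / J
      - (∑ j ∈ Finset.range J', (law j).real {y}) / J'| ≤ 2 * η) :
    |(∑ j ∈ Finset.range J, ∫ x, f x ∂law j) / J
      - (∑ j ∈ Finset.range J', ∫ x, f x ∂law j) / J'| ≤ 4 * M * η := by
  have hsplit : ∀ j, ∫ x, f x ∂law j
      = ∑ y ∈ F, f y * (law j).real {y} + ∫ x in (F : Set X)ᶜ, f x ∂law j := by
    intro j
    have hi := integrable_of_abs_le (law j) hf
    rw [← integral_add_compl (s := (F : Set X)) (MeasurableSet.of_discrete) hi,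
      setIntegral_finset F hi.integrableOn]
    simp [mul_comm]
  have hrest : ∀ j, |∫ x in (F : Set X)ᶜ, f x ∂law j| ≤ M * η := by
    intro j
    rw [← Real.norm_eq_abs]
    exact (norm_setIntegral_le_of_norm_le_const (measure_lt_top _ _) fun x _ => hf x).trans
      (mul_le_mul_of_nonneg_left (hF j) hM)
  have havg : ∀ J : ℕ, 0 < J →
      |(∑ j ∈ Finset.range J, ∫ x, f x ∂law j) / J
        - ∑ y ∈ F, f y * ((∑ j ∈ Finset.range J, (law j).real {y}) / J)| ≤ M * η := by
    intro J hJ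
    have hJr : (0 : ℝ) < J := by exact_mod_cast hJ
    have h1 : (∑ j ∈ Finset.range J, ∫ x, f x ∂law j) / J
        - ∑ y ∈ F, f y * ((∑ j ∈ Finset.range J, (law j).real {y}) / J)
        = (∑ j ∈ Finset.range J, ∫ x in (F : Set X)ᶜ, f x ∂law j) / J := by
      have h2 : ∑ y ∈ F, f y * ((∑ j ∈ Finset.range J, (law j).real {y}) / J)
          = (∑ j ∈ Finset.range J, ∑ y ∈ F, f y * (law j).real {y}) / J := by
        rw [Finset.sum_comm, Finset.sum_div]
        refine Finset.sum_congr rfl fun y _ => ?_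
        rw [← Finset.mul_sum, mul_div_assoc]
      rw [h2, Finset.sum_congr rfl fun j _ => hsplit j, Finset.sum_add_distrib]
      ring
    rw [h1, abs_div, Nat.abs_cast, div_le_iff₀ hJr]
    calc _ ≤ ∑ j ∈ Finset.range J, |∫ x in (F : Set X)ᶜ, f x ∂law j| :=
          Finset.abs_sum_le_sum_abs _ _
      _ ≤ ∑ j ∈ Finset.range J, M * η := Finset.sum_le_sum fun j _ => hrest j
      _ = M * η * J := by rw [Finset.sum_const, Finset.card_range, nsmul_eq_mul, mul_comm]
  have hmain : |∑ y ∈ F, f y * ((∑ j ∈ Finset.range J, (law j).real {y}) / J)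
      - ∑ y ∈ F, f y * ((∑ j ∈ Finset.range J', (law j).real {y}) / J')| ≤ M * (2 * η) := by
    rw [← Finset.sum_sub_distrib]
    refine (Finset.abs_sum_le_sum_abs _ _).trans ?_
    refine le_trans ?_ (mul_le_mul_of_nonneg_left hclose hM)
    rw [Finset.mul_sum]
    refine Finset.sum_le_sum fun y _ => ?_
    rw [← mul_sub, abs_mul]
    exact mul_le_mul_of_nonneg_right (hf y) (abs_nonneg _)
  have h1 := abs_le.1 (havg J hJ)
  have h2 := abs_le.1 (havg J' hJ')
  have h3 := abs_le.1 hmain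
  rw [abs_le]
  constructor <;> linarith

/-- **Mean ergodic theorem** for a tight Markov chain on a countable space: the averages of the
expectations of a bounded function converge. -/
theorem exists_tendsto_average_integral (κ : Kernel X X) [IsMarkovKernel κ]
    (law : ℕ → Measure X) [∀ k, IsProbabilityMeasure (law k)]
    (hstep : ∀ k, law (k + 1) = (law k).bind κ)
    (htight : ∀ η : ℝ, 0 < η → ∃ F : Finset X, ∀ k, (law k).real (F : Set X)ᶜ ≤ η)
    {f : X → ℝ} {M : ℝ} (hf : ∀ x, |f x| ≤ M) :
    ∃ l, Tendsto (fun K : ℕ => (∑ k ∈ Finset.range K, ∫ x, f x ∂law k) / K) atTop (𝓝 l) := by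
  have hM : 0 ≤ M := by
    have := (nonempty_of_isProbabilityMeasure (law 0))
    exact (abs_nonneg _).trans (hf (Classical.arbitrary X))
  set a : ℕ → ℝ := fun k => ∫ x, f x ∂law k with ha
  set c : ℕ → ℝ := fun K => (∑ k ∈ Finset.range K, a k) / K with hc
  have haM : ∀ k, |a k| ≤ M := fun k => abs_integral_le_of_abs_le _ hf
  -- iterates of the transition operator
  set h : ℕ → X → ℝ := fun n => (fun g x => ∫ y, g y ∂κ x)^[n] f with hh
  have hbd : ∀ n x, |h n x| ≤ M := by
    intro n
    induction n with
    | zero => exact hf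
    | succ n ih =>
      intro x
      simp only [hh, Function.iterate_succ_apply']
      exact abs_integral_le_of_abs_le _ ih
  have hint : ∀ n j, ∫ x, h n x ∂law j = a (j + n) := by
    intro n
    induction n with
    | zero => intro j; rfl
    | succ n ih =>
      intro j
      rw [← add_assoc, add_right_comm, ← ih, hstep, integral_bind_of_abs_le κ _ (hbd n)]
      simp only [hh, Function.iterate_succ_apply']
  set g : ℕ → X → ℝ := fun K x => (∑ k ∈ Finset.range K, h k x) / K with hg
  have hgbd : ∀ K, 0 < K → ∀ x, |g K x| ≤ M := by
    intro K hK x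
    have hKr : (0 : ℝ) < K := by exact_mod_cast hK
    simp only [hg]
    rw [abs_div, Nat.abs_cast, div_le_iff₀ hKr]
    calc _ ≤ ∑ k ∈ Finset.range K, |h k x| := Finset.abs_sum_le_sum_abs _ _
      _ ≤ ∑ k ∈ Finset.range K, M := Finset.sum_le_sum fun k _ => hbd k x
      _ = M * K := by rw [Finset.sum_const, Finset.card_range, nsmul_eq_mul, mul_comm]
  have hgint : ∀ K j, ∫ x, g K x ∂law j = (∑ k ∈ Finset.range K, a (j + k)) / K := by
    intro K j
    simp only [hg]
    rw [integral_div, integral_finsetSum]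
    · simp_rw [hint]
    · exact fun k _ => integrable_of_abs_le _ (hbd k)
  suffices hcs : CauchySeq c from cauchySeq_tendsto_of_complete hcs
  rw [Metric.cauchySeq_iff]
  intro e he
  -- Two comparisons, each costing `4 * M * η + 2 * η`, must add up to less than `e`.
  set η := e / (8 * M + 5) with hη
  have hηpos : 0 < η := by positivity
  have hηe : 8 * M * η + 4 * η < e := by
    have : η * (8 * M + 5) = e := by rw [hη]; field_simp
    nlinarith
  obtain ⟨F, hF⟩ := htight η hηpos
  -- The averaged laws restricted to `F` live in a compact cube; a convergent subsequence stands in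
  -- for an invariant measure.
  set v : ℕ → F → ℝ := fun J y => (∑ j ∈ Finset.range J, (law j).real {y.1}) / J with hv
  obtain ⟨w, -, φ, hφ, hlim⟩ := (isCompact_Icc (a := (0 : F → ℝ)) (b := 1)).tendsto_subseq
    (x := v) (by
      intro J
      constructor
      · intro y
        simp only [hv, Pi.zero_apply]
        positivity
      · intro y
        simp only [hv, Pi.one_apply]
        refine div_le_one_of_le₀ ?_ (Nat.cast_nonneg _)
        calc _ ≤ ∑ j ∈ Finset.range J, (1 : ℝ) := Finset.sum_le_sum fun j _ => measureReal_le_one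
          _ = J := by simp)
  have hsum : Tendsto (fun n => ∑ y : F, |v (φ n) y - w y|) atTop (𝓝 0) := by
    have : Tendsto (fun n => ∑ y : F, |v (φ n) y - w y|) atTop (𝓝 (∑ y : F, |w y - w y|)) :=
      tendsto_finsetSum _ fun y _ => ((tendsto_pi_nhds.1 hlim y).sub_const (w y)).abs
    simpa using this
  obtain ⟨n₀, hn₀⟩ := (((hsum.eventually (gt_mem_nhds hηpos)).and
    (eventually_gt_atTop 0)).and (eventually_ge_atTop 0)).exists_forall_of_atTop
  have hφpos : ∀ n ≥ n₀, 0 < φ n := fun n hn => (hn₀ n hn).1.2.trans_le (hφ.id_le n)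
  set J := φ n₀ with hJdef
  have hJ : 0 < J := hφpos n₀ le_rfl
  have hclose : ∀ n ≥ n₀, ∑ y ∈ F, |(∑ j ∈ Finset.range J, (law j).real {y}) / J
      - (∑ j ∈ Finset.range (φ n), (law j).real {y}) / (φ n : ℕ)| ≤ 2 * η := by
    intro n hn
    rw [← Finset.sum_coe_sort F]
    calc _ ≤ ∑ y : F, (|v (φ n₀) y - w y| + |v (φ n) y - w y|) := by
          refine Finset.sum_le_sum fun y _ => ?_
          rw [abs_sub_comm (v (φ n) y)]
          exact abs_sub_le (v (φ n₀) y) (w y) (v (φ n) y)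
      _ ≤ 2 * η := by
          rw [Finset.sum_add_distrib]
          have h1 := (hn₀ n₀ le_rfl).1.1
          have h2 := (hn₀ n hn).1.1
          linarith
  obtain ⟨K₀, hK₀⟩ := (((tendsto_const_div_atTop_nhds_zero_nat (2 * M * J)).eventually
    (gt_mem_nhds hηpos)).and (eventually_gt_atTop 0)).exists_forall_of_atTop
  have hφtop : Tendsto (fun n => (φ n : ℕ)) atTop atTop := hφ.tendsto_atTop
  -- Integrating `g K` against the laws averaged over `J`, or over `φ n`, gives a double average of
  -- `a`. The first is close to `c K` since `K` is large compared with `J`, the second to `c (φ n)`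
  -- since `φ n` is large compared with `K`. Every `c K` with `K ≥ K₀` is thus close to the same
  -- tail of `c ∘ φ`.
  have hcK : ∀ K ≥ K₀, ∀ᶠ n in atTop, |c K - c (φ n)| ≤ 4 * M * η + 2 * η := by
    intro K hK
    obtain ⟨hK1, hK2⟩ := hK₀ K hK
    have hlim' := ((tendsto_const_div_atTop_nhds_zero_nat (2 * M * K)).comp hφtop).eventually
      (gt_mem_nhds hηpos)
    filter_upwards [hlim', eventually_ge_atTop n₀] with n hn1 hn2
    have e1 := abs_average_average_sub_average_le haM hJ K
    have e2 := abs_average_integral_sub_le hF (hgbd K hK2) hM hJ (hφpos n hn2) (hclose n hn2)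
    simp_rw [hgint] at e2
    have e3 := abs_average_average_sub_average_le haM hK2 (φ n)
    rw [average_average_comm a (φ n) K] at e2
    have e1' := abs_le.1 e1
    have e2' := abs_le.1 e2
    have e3' := abs_le.1 e3
    simp only [Function.comp_apply] at hn1
    simp only [hc]
    rw [abs_le]
    constructor <;> linarith
  refine ⟨K₀, fun K hK K' hK' => ?_⟩
  obtain ⟨n, hn1, hn2⟩ := ((hcK K hK).and (hcK K' hK')).exists
  rw [Real.dist_eq]
  have h1 := abs_le.1 hn1
  have h2 := abs_le.1 hn2
  rw [abs_lt]
  constructor <;> linarith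

end Markov

/-! ### Killed chains, Foster's criterion and tightness -/

lemma indicator_compl_le_one {X : Type*} (F : Finset X) :
    (F : Set X)ᶜ.indicator (1 : X → ℝ≥0∞) ≤ 1 :=
  Set.indicator_le_self' fun _ _ => zero_le_one

lemma tendsto_indicator_compl_finset {X : Type*} (x : X) :
    Tendsto (fun F : Finset X => (F : Set X)ᶜ.indicator (1 : X → ℝ≥0∞) x) atTop (𝓝 0) := by
  refine tendsto_const_nhds.congr' ?_
  filter_upwards [eventually_ge_atTop ({x} : Finset X)] with F hF
  simp [Finset.singleton_subset_iff.1 hF]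

section Taboo

variable {X : Type*} [MeasurableSpace X]

/-- The transition operator of the Markov chain with kernel `κ` killed when it enters `B`. -/
noncomputable def tabooOp (κ : Kernel X X) (B : Finset X) (f : X → ℝ≥0∞) (x : X) : ℝ≥0∞ :=
  ∫⁻ y in (B : Set X)ᶜ, f y ∂κ x

lemma tabooOp_mono (κ : Kernel X X) (B : Finset X) : Monotone (tabooOp κ B) :=
  fun _ _ h _ => lintegral_mono h

/-- The left side at `x` is the probability that the chain from `x` avoids `B` at times `1, …, n`.
Its sum over `n` is therefore the expected hitting time; the starting point itself is not tested. -/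
lemma tabooOp_iterate_one_le (κ : Kernel X X) [IsMarkovKernel κ] (B : Finset X) (n : ℕ) :
    (tabooOp κ B)^[n] 1 ≤ 1 := by
  induction n with
  | zero => exact le_rfl
  | succ n ih =>
    rw [Function.iterate_succ_apply']
    refine (tabooOp_mono κ B ih).trans fun x => ?_
    simp only [tabooOp, Pi.one_apply, lintegral_one, Measure.restrict_apply_univ]
    exact prob_le_one

variable [DiscreteMeasurableSpace X]

/-- **Foster's criterion.** -/
theorem tsum_tabooOp_iterate_ne_top (κ : Kernel X X) [IsMarkovKernel κ] {B : Finset X}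
    {V : X → ℝ≥0∞} (hV : ∀ x, ∫⁻ y, V y ∂κ x ≠ ∞)
    (hdrift : ∀ x ∉ B, ∫⁻ y, V y ∂κ x + 1 ≤ V x) (x : X) :
    ∑' n, (tabooOp κ B)^[n] 1 x ≠ ∞ := by
  -- The killed operator only evaluates functions off `B`, so a bound by `V` there controls one more
  -- term at every point; the drift condition then restores the bound off `B`.
  have hstep : ∀ n, (∀ y ∉ B, ∑ i ∈ Finset.range n, (tabooOp κ B)^[i] 1 y ≤ V y) →
      ∀ x, ∑ i ∈ Finset.range (n + 1), (tabooOp κ B)^[i] 1 x ≤ ∫⁻ y, V y ∂κ x + 1 := by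
    intro n hn x
    rw [Finset.sum_range_succ']
    refine add_le_add ?_ le_rfl
    simp only [Function.iterate_succ_apply']
    calc ∑ i ∈ Finset.range n, tabooOp κ B ((tabooOp κ B)^[i] 1) x
        = ∫⁻ y in (B : Set X)ᶜ, ∑ i ∈ Finset.range n, (tabooOp κ B)^[i] 1 y ∂κ x := by
          rw [lintegral_finsetSum _ fun _ _ => Measurable.of_discrete]; rfl
      _ ≤ ∫⁻ y in (B : Set X)ᶜ, V y ∂κ x :=
          setLIntegral_mono' MeasurableSet.of_discrete fun y hy => hn y (by simpa using hy)
      _ ≤ ∫⁻ y, V y ∂κ x := setLIntegral_le_lintegral _ _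
  have hall : ∀ n, ∀ y ∉ B, ∑ i ∈ Finset.range n, (tabooOp κ B)^[i] 1 y ≤ V y := by
    intro n
    induction n with
    | zero => simp
    | succ n ih => exact fun y hy => (hstep n ih y).trans (hdrift y hy)
  refine ne_top_of_le_ne_top (ENNReal.add_ne_top.2 ⟨hV x, ENNReal.one_ne_top⟩)
    (ENNReal.tsum_le_of_sum_range_le fun n => ?_)
  exact le_trans (Finset.sum_le_sum_of_subset (Finset.range_mono n.le_succ)) (hstep n (hall n) x)

variable [Countable X]

lemma tendsto_tabooOp_iterate_indicator (κ : Kernel X X) [IsMarkovKernel κ] (B : Finset X) (n : ℕ)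
    (x : X) : Tendsto (fun F : Finset X =>
      (tabooOp κ B)^[n] ((F : Set X)ᶜ.indicator 1) x) atTop (𝓝 0) := by
  induction n generalizing x with
  | zero => exact tendsto_indicator_compl_finset x
  | succ n ih =>
    simp only [Function.iterate_succ_apply']
    -- Dominated convergence along finite sets is legitimate because `X` is countable, so `atTop` on
    -- `Finset X` is countably generated.
    have h := tendsto_lintegral_filter_of_dominated_convergence
      (μ := (κ x).restrict (B : Set X)ᶜ) (l := (atTop : Filter (Finset X)))
      (F := fun F y => (tabooOp κ B)^[n] ((F : Set X)ᶜ.indicator 1) y) (f := fun _ => 0) 1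
      (Eventually.of_forall fun _ => Measurable.of_discrete)
      (Eventually.of_forall fun F => ae_of_all _ fun y =>
        ((tabooOp_mono κ B).iterate n (indicator_compl_le_one F)).trans
          (tabooOp_iterate_one_le κ B n) y)
      (by simp) (ae_of_all _ ih)
    simpa [tabooOp] using h

/-- A last-exit decomposition. -/
lemma lintegral_law_le (κ : Kernel X X) [IsMarkovKernel κ] (B : Finset X) (law : ℕ → Measure X)
    [∀ k, IsProbabilityMeasure (law k)] (hstep : ∀ k, law (k + 1) = (law k).bind κ) (k : ℕ)
    (f : X → ℝ≥0∞) :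
    ∫⁻ x, f x ∂law k ≤ ∫⁻ x, (tabooOp κ B)^[k] f x ∂law 0
      + ∑ n ∈ Finset.range k, ∑ b ∈ B, (tabooOp κ B)^[n] f b := by
  induction k generalizing f with
  | zero => simp
  | succ k ih =>
    -- A step either avoids `B` or lands at some `b ∈ B`, with probability at most `1`. This crude
    -- bound suffices since the resulting series over `n` converges.
    have hx : ∀ x, ∫⁻ y, f y ∂κ x ≤ tabooOp κ B f x + ∑ b ∈ B, f b := by
      intro x
      rw [← lintegral_add_compl f (A := (B : Set X)) MeasurableSet.of_discrete, add_comm]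
      refine add_le_add le_rfl ?_
      rw [lintegral_finset]
      exact Finset.sum_le_sum fun b _ => mul_le_of_le_one_right' prob_le_one
    calc ∫⁻ x, f x ∂law (k + 1) = ∫⁻ x, ∫⁻ y, f y ∂κ x ∂law k := by
          rw [hstep, Measure.lintegral_bind κ.aemeasurable (Measurable.of_discrete).aemeasurable]
      _ ≤ ∫⁻ x, (tabooOp κ B f x + ∑ b ∈ B, f b) ∂law k := lintegral_mono hx
      _ = ∫⁻ x, tabooOp κ B f x ∂law k + ∑ b ∈ B, f b := by
          rw [lintegral_add_right _ measurable_const]; simp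
      _ ≤ _ := by
          rw [Finset.sum_range_succ', ← add_assoc]
          simpa only [Function.iterate_succ_apply, Function.iterate_zero_apply]
            using add_le_add_left (ih (tabooOp κ B f)) _

/-- A Markov chain whose expected hitting times of a finite set are finite is tight. -/
theorem exists_finset_law_compl_le (κ : Kernel X X) [IsMarkovKernel κ] {B : Finset X}
    (hB : ∀ x, ∑' n, (tabooOp κ B)^[n] 1 x ≠ ∞) (law : ℕ → Measure X)
    [∀ k, IsProbabilityMeasure (law k)] (hstep : ∀ k, law (k + 1) = (law k).bind κ)
    {η : ℝ} (hη : 0 < η) : ∃ F : Finset X, ∀ k, (law k).real (F : Set X)ᶜ ≤ η := by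
  set T := tabooOp κ B
  have hη' : 0 < ENNReal.ofReal η / 2 := by simpa using hη
  -- The probability of not having met `B` by time `k` vanishes for any initial law, even if the
  -- hitting time has infinite mean under it.
  have h1 : Tendsto (fun k => ∫⁻ x, T^[k] 1 x ∂law 0) atTop (𝓝 0) := by
    have h := tendsto_lintegral_of_dominated_convergence (μ := law 0) (F := fun k => T^[k] 1)
      (f := fun _ => 0) 1 (fun _ => Measurable.of_discrete)
      (fun n => ae_of_all _ (tabooOp_iterate_one_le κ B n)) (by simp)
      (ae_of_all _ fun x => ENNReal.tendsto_atTop_zero_of_tsum_ne_top (hB x))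
    simpa using h
  obtain ⟨k₀, hk₀⟩ := (h1.eventually_le_const hη').exists_forall_of_atTop
  -- Dominated convergence for sums over `n`: the majorant is the sum of the expected return times
  -- from the points of `B`. This controls all `k ≥ k₀` uniformly; the finitely many smaller `k` are
  -- handled one by one.
  have h2 : Tendsto (fun F : Finset X => ∑' n, ∑ b ∈ B, T^[n] ((F : Set X)ᶜ.indicator 1) b) atTop
      (𝓝 0) := by
    have h := tendsto_lintegral_filter_of_dominated_convergence (μ := (Measure.count : Measure ℕ))
      (l := (atTop : Filter (Finset X)))
      (F := fun F n => ∑ b ∈ B, T^[n] ((F : Set X)ᶜ.indicator 1) b) (f := fun _ => 0)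
      (fun n => ∑ b ∈ B, T^[n] 1 b) (Eventually.of_forall fun _ => Measurable.of_discrete)
      (Eventually.of_forall fun F => ae_of_all _ fun n => Finset.sum_le_sum fun b _ =>
        (tabooOp_mono κ B).iterate n (indicator_compl_le_one F) b)
      (by
        rw [lintegral_count, Summable.tsum_finsetSum fun _ _ => ENNReal.summable]
        exact ENNReal.sum_ne_top.2 fun b _ => hB b)
      (ae_of_all _ fun n => by
        simpa using tendsto_finsetSum B fun b _ => tendsto_tabooOp_iterate_indicator κ B n b)
    simpa [lintegral_count] using h
  have h3 : ∀ k, Tendsto (fun F : Finset X => law k (F : Set X)ᶜ) atTop (𝓝 0) := by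
    intro k
    have h := tendsto_lintegral_filter_of_dominated_convergence (μ := law k)
      (l := (atTop : Filter (Finset X)))
      (F := fun F => (F : Set X)ᶜ.indicator 1) (f := fun _ => 0)
      1 (Eventually.of_forall fun _ => Measurable.of_discrete)
      (Eventually.of_forall fun F => ae_of_all _ (indicator_compl_le_one F))
      (by simp) (ae_of_all _ tendsto_indicator_compl_finset)
    simpa only [lintegral_indicator_one MeasurableSet.of_discrete, lintegral_zero] using h
  have h4 : ∀ᶠ F : Finset X in atTop, ∀ k ∈ Finset.range k₀,
      law k (F : Set X)ᶜ ≤ ENNReal.ofReal η / 2 :=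
    (Finset.eventually_all _).2 fun k _ => (h3 k).eventually_le_const hη'
  obtain ⟨F, hF1, hF2⟩ := (h4.and (h2.eventually_le_const hη')).exists
  refine ⟨F, fun k => ?_⟩
  suffices h : law k (F : Set X)ᶜ ≤ ENNReal.ofReal η from ENNReal.toReal_le_of_le_ofReal hη.le h
  rcases lt_or_ge k k₀ with hk | hk
  · exact (hF1 k (Finset.mem_range.2 hk)).trans ENNReal.half_le_self
  · rw [← lintegral_indicator_one (μ := law k) MeasurableSet.of_discrete]
    refine (lintegral_law_le κ B law hstep k _).trans ?_
    rw [← ENNReal.add_halves (ENNReal.ofReal η)]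
    refine add_le_add (le_trans (lintegral_mono ?_) (hk₀ k hk)) (le_trans ?_ hF2)
    · exact (tabooOp_mono κ B).iterate k (indicator_compl_le_one F)
    · exact ENNReal.sum_le_tsum _

end Taboo

/-- Pathwise tail-sum formula: the `n`-th product is the indicator that the hitting time exceeds
`n`, with value `1` at `n = 0`. If `B` is never hit, both sides are infinite. -/
lemma iInf_hitting_eq_tsum_prod {X : Type*} (B : Finset X) (x : ℕ → X) :
    (⨅ (k : ℕ) (_ : 1 ≤ k) (_ : x k ∈ B), (k : ℝ≥0∞))
      = ∑' n, ∏ j ∈ Finset.Icc 1 n, (B : Set X)ᶜ.indicator (1 : X → ℝ≥0∞) (x j) := by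
  classical
  by_cases h : ∃ k, 1 ≤ k ∧ x k ∈ B
  · obtain ⟨h1, h2⟩ := Nat.find_spec h
    set k₀ := Nat.find h with hk₀
    have hone : ∀ n ∈ Finset.range k₀,
        ∏ j ∈ Finset.Icc 1 n, (B : Set X)ᶜ.indicator (1 : X → ℝ≥0∞) (x j) = 1 := by
      intro n hn
      refine Finset.prod_eq_one fun j hj => ?_
      obtain ⟨hj1, hj2⟩ := Finset.mem_Icc.1 hj
      have hnot : x j ∉ B := fun hB =>
        Nat.find_min h (hj2.trans_lt (Finset.mem_range.1 hn)) ⟨hj1, hB⟩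
      simp [hnot]
    rw [tsum_eq_sum (s := Finset.range k₀), Finset.sum_congr rfl hone]
    · simp only [Finset.sum_const, Finset.card_range, nsmul_eq_mul, mul_one]
      refine le_antisymm (iInf_le_of_le k₀ (iInf_le_of_le h1 (iInf_le_of_le h2 le_rfl))) ?_
      refine le_iInf fun k => le_iInf fun hk1 => le_iInf fun hk2 => ?_
      exact_mod_cast Nat.find_min' h ⟨hk1, hk2⟩
    · intro n hn
      refine Finset.prod_eq_zero (i := k₀) (Finset.mem_Icc.2 ⟨h1, ?_⟩) (by simp [h2])
      simpa using hn
  · push Not at h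
    have h1 : ∀ n, ∏ j ∈ Finset.Icc 1 n, (B : Set X)ᶜ.indicator (1 : X → ℝ≥0∞) (x j) = 1 :=
      fun n => Finset.prod_eq_one fun j hj => by simp [h j (Finset.mem_Icc.1 hj).1]
    simp_rw [h1, ENNReal.tsum_const_eq_top_of_ne_zero one_ne_zero]
    refine le_antisymm le_top (le_iInf fun k => le_iInf fun hk1 => le_iInf fun hk2 => ?_)
    exact absurd hk2 (h k hk1)

/-! ### Independence of pairs -/

lemma comap_prodMk_eq_generateFrom {Ω α γ : Type*} [MeasurableSpace α] [MeasurableSpace γ]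
    (f : Ω → α) (u : Ω → γ) :
    MeasurableSpace.comap (fun ω => (f ω, u ω)) inferInstance = MeasurableSpace.generateFrom
      {t | ∃ s ∈ Set.image2 (· ×ˢ ·) {s : Set α | MeasurableSet s} {t : Set γ | MeasurableSet t},
        (fun ω => (f ω, u ω)) ⁻¹' s = t} := by
  rw [← generateFrom_prod, MeasurableSpace.comap_generateFrom]
  rfl

section Independence

variable {Ω : Type*} [MeasurableSpace Ω] {μ : Measure Ω} [IsProbabilityMeasure μ]

/-- Regroups past and present queries `f`, `g` and past and present requirements `u`, `v` into past
against present. On rectangles all four factors split, and rectangles form a generating π-system. -/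
lemma ProbabilityTheory.IndepFun.prodMk_prodMk {α β γ δ : Type*} [MeasurableSpace α]
    [MeasurableSpace β] [MeasurableSpace γ] [MeasurableSpace δ] {f : Ω → α} {g : Ω → β}
    {u : Ω → γ} {v : Ω → δ} (hf : Measurable f) (hg : Measurable g) (hu : Measurable u)
    (hv : Measurable v) (hfg : IndepFun f g μ) (huv : IndepFun u v μ)
    (h : IndepFun (fun ω => (f ω, g ω)) (fun ω => (u ω, v ω)) μ) :
    IndepFun (fun ω => (f ω, u ω)) (fun ω => (g ω, v ω)) μ := by
  have hrect : ∀ (s : Set α) (t : Set γ) (s' : Set β) (t' : Set δ), MeasurableSet s →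
      MeasurableSet t → MeasurableSet s' → MeasurableSet t' →
      μ (f ⁻¹' s ∩ u ⁻¹' t ∩ (g ⁻¹' s' ∩ v ⁻¹' t'))
        = μ (f ⁻¹' s) * μ (g ⁻¹' s') * (μ (u ⁻¹' t) * μ (v ⁻¹' t')) := by
    intro s t s' t' hs ht hs' ht'
    rw [← hfg.measure_inter_preimage_eq_mul _ _ hs hs',
      ← huv.measure_inter_preimage_eq_mul _ _ ht ht']
    have := h.measure_inter_preimage_eq_mul _ _ (hs.prod hs') (ht.prod ht')
    refine Eq.trans ?_ this
    congr 1
    ext ω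
    simp only [Set.mem_inter_iff, Set.mem_preimage, Set.mem_prod]
    tauto
  rw [IndepFun_iff_Indep]
  refine IndepSets.indep (hf.prodMk hu).comap_le (hg.prodMk hv).comap_le (isPiSystem_prod.comap _)
    (isPiSystem_prod.comap _) (comap_prodMk_eq_generateFrom f u)
    (comap_prodMk_eq_generateFrom g v) ?_
  rw [IndepSets_iff]
  rintro _ _ ⟨_, ⟨s, hs, t, ht, rfl⟩, rfl⟩ ⟨_, ⟨s', hs', t', ht', rfl⟩, rfl⟩
  have h1 := hrect s t s' t' hs ht hs' ht'
  have h2 := hrect s t Set.univ Set.univ hs ht .univ .univ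
  have h3 := hrect Set.univ Set.univ s' t' .univ .univ hs' ht'
  simp only [Set.preimage_univ, Set.inter_univ, Set.univ_inter, measure_univ, mul_one,
    one_mul] at h2 h3
  simp only [Set.mk_preimage_prod]
  rw [h1, h2, h3]
  ring

lemma ProbabilityTheory.IndepFun.lintegral_eq {Z E : Type*} [MeasurableSpace Z]
    [MeasurableSpace E] {Y : Ω → Z} {ξ : Ω → E} (h : IndepFun Y ξ μ) (hY : Measurable Y)
    (hξ : Measurable ξ) {G : Z × E → ℝ≥0∞} (hG : Measurable G) :
    ∫⁻ ω, G (Y ω, ξ ω) ∂μ = ∫⁻ ω, ∫⁻ e, G (Y ω, e) ∂(μ.map ξ) ∂μ := by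
  have := Measure.isProbabilityMeasure_map (μ := μ) hξ.aemeasurable
  rw [← lintegral_map (g := fun ω => (Y ω, ξ ω)) hG (hY.prodMk hξ),
    h.map_prod_eq_prod_map_map hY.aemeasurable hξ.aemeasurable, lintegral_prod _ hG.aemeasurable,
    lintegral_map hG.lintegral_prod_right' hY]

lemma ProbabilityTheory.IndepFun.integral_eq {Z E : Type*} [MeasurableSpace Z]
    [MeasurableSpace E] {Y : Ω → Z} {ξ : Ω → E} (h : IndepFun Y ξ μ) (hY : Measurable Y)
    (hξ : Measurable ξ) {G : Z × E → ℝ} (hG : Measurable G) {M : ℝ} (hM : ∀ z, |G z| ≤ M) :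
    ∫ ω, G (Y ω, ξ ω) ∂μ = ∫ z, ∫ e, G (z, e) ∂(μ.map ξ) ∂(μ.map Y) := by
  have := Measure.isProbabilityMeasure_map (μ := μ) hξ.aemeasurable
  have := Measure.isProbabilityMeasure_map (μ := μ) hY.aemeasurable
  rw [← integral_map (φ := fun ω => (Y ω, ξ ω)) (hY.prodMk hξ).aemeasurable
    hG.aestronglyMeasurable, h.map_prod_eq_prod_map_map hY.aemeasurable hξ.aemeasurable,
    integral_prod]
  exact Integrable.of_bound hG.aestronglyMeasurable M (ae_of_all _ hM)

end Independence

/-! ### Recursions driven by i.i.d. noise -/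

section RandomRecursion

variable {X E : Type*} [MeasurableSpace X] [DiscreteMeasurableSpace X] [Countable X]
  [MeasurableSpace E] [DiscreteMeasurableSpace E]

/-- The Markov kernel of the random recursion `x ↦ Φ x ξ` with noise `ξ` of law `ν`. -/
noncomputable def recursionKernel (Φ : X → E → X) (ν : Measure E) : Kernel X X :=
  Kernel.ofFunOfCountable fun x => ν.map (Φ x)

instance (Φ : X → E → X) (ν : Measure E) [IsProbabilityMeasure ν] :
    IsMarkovKernel (recursionKernel Φ ν) :=
  ⟨fun _ => Measure.isProbabilityMeasure_map (Measurable.of_discrete).aemeasurable⟩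

lemma lintegral_recursionKernel (Φ : X → E → X) (ν : Measure E) (f : X → ℝ≥0∞) (x : X) :
    ∫⁻ y, f y ∂recursionKernel Φ ν x = ∫⁻ e, f (Φ x e) ∂ν :=
  lintegral_map Measurable.of_discrete Measurable.of_discrete

variable [Countable E] {Ω : Type*} [MeasurableSpace Ω] {μ : Measure Ω} [IsProbabilityMeasure μ]

lemma map_succ_eq_bind {Φ : X → E → X} {Y : ℕ → Ω → X} {ξ : ℕ → Ω → E} {ν : Measure E}
    (hY : ∀ k, Measurable (Y k)) (hξ : ∀ k, Measurable (ξ k)) (hν : ∀ k, μ.map (ξ k) = ν)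
    (hrec : ∀ k ω, Y (k + 1) ω = Φ (Y k ω) (ξ k ω)) (hind : ∀ k, IndepFun (Y k) (ξ k) μ) (k : ℕ) :
    μ.map (Y (k + 1)) = (μ.map (Y k)).bind (recursionKernel Φ ν) := by
  refine Measure.ext_of_lintegral _ fun f hf => ?_
  rw [Measure.lintegral_bind (Kernel.aemeasurable _) hf.aemeasurable, lintegral_map hf (hY _),
    lintegral_map Measurable.of_discrete (hY k)]
  simp_rw [hrec, lintegral_recursionKernel]
  rw [(hind k).lintegral_eq (hY k) (hξ k) (G := fun p => f (Φ p.1 p.2)) Measurable.of_discrete,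
    hν k]

/-- Iterated Markov property: integrating out the last noise variable turns the final factor into
`tabooOp` applied to `f`, which is why the induction is over all `f`. -/
lemma lintegral_prod_indicator_mul {Φ : X → E → X} {Y : ℕ → Ω → X} {ξ : ℕ → Ω → E}
    {ν : Measure E} {x : X} (hY : ∀ k, Measurable (Y k)) (hξ : ∀ k, Measurable (ξ k))
    (hν : ∀ k, μ.map (ξ k) = ν) (hzero : ∀ ω, Y 0 ω = x)
    (hrec : ∀ k ω, Y (k + 1) ω = Φ (Y k ω) (ξ k ω))
    (hind : ∀ k, IndepFun (fun ω (j : Finset.range (k + 1)) => Y j ω) (ξ k) μ) (B : Finset X)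
    (n : ℕ) (f : X → ℝ≥0∞) :
    ∫⁻ ω, (∏ j ∈ Finset.Icc 1 n, (B : Set X)ᶜ.indicator (1 : X → ℝ≥0∞) (Y j ω)) * f (Y n ω) ∂μ
      = (tabooOp (recursionKernel Φ ν) B)^[n] f x := by
  classical
  induction n generalizing f with
  | zero => simp [hzero]
  | succ n ih =>
    rw [Function.iterate_succ_apply, ← ih]
    -- The avoidance product as a function of the path up to time `n`; the `else` value is never
    -- used.
    set S : (Finset.range (n + 1) → X) → ℝ≥0∞ := fun p => ∏ j ∈ Finset.Icc 1 n,
      if h : j ∈ Finset.range (n + 1) then (B : Set X)ᶜ.indicator 1 (p ⟨j, h⟩) else 1 with hS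
    have hSY : ∀ ω, S (fun j => Y j ω)
        = ∏ j ∈ Finset.Icc 1 n, (B : Set X)ᶜ.indicator (1 : X → ℝ≥0∞) (Y j ω) := by
      intro ω
      refine Finset.prod_congr rfl fun j hj => ?_
      rw [dif_pos (Finset.mem_range.2 (Nat.lt_succ_of_le (Finset.mem_Icc.1 hj).2))]
    have h := (hind n).lintegral_eq (measurable_pi_lambda _ fun j => hY j) (hξ n)
      (G := fun p => S p.1 * (B : Set X)ᶜ.indicator f
        (Φ (p.1 ⟨n, Finset.self_mem_range_succ n⟩) p.2)) Measurable.of_discrete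
    simp only [hSY, hν, ← hrec] at h
    have h1 : ∀ ω, (∏ j ∈ Finset.Icc 1 (n + 1),
        (B : Set X)ᶜ.indicator (1 : X → ℝ≥0∞) (Y j ω)) * f (Y (n + 1) ω)
        = (∏ j ∈ Finset.Icc 1 n, (B : Set X)ᶜ.indicator (1 : X → ℝ≥0∞) (Y j ω))
          * (B : Set X)ᶜ.indicator f (Y (n + 1) ω) := by
      intro ω
      rw [Finset.prod_Icc_succ_top (by omega), mul_assoc]
      congr 1
      by_cases hb : Y (n + 1) ω ∈ B <;> simp [hb]
    simp_rw [h1, h]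
    refine lintegral_congr fun ω => ?_
    rw [lintegral_const_mul _ Measurable.of_discrete, tabooOp,
      ← lintegral_indicator MeasurableSet.of_discrete, lintegral_recursionKernel]

theorem lintegral_hitting_eq_tsum {Φ : X → E → X} {Y : ℕ → Ω → X} {ξ : ℕ → Ω → E}
    {ν : Measure E} {x : X} (hY : ∀ k, Measurable (Y k)) (hξ : ∀ k, Measurable (ξ k))
    (hν : ∀ k, μ.map (ξ k) = ν) (hzero : ∀ ω, Y 0 ω = x)
    (hrec : ∀ k ω, Y (k + 1) ω = Φ (Y k ω) (ξ k ω))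
    (hind : ∀ k, IndepFun (fun ω (j : Finset.range (k + 1)) => Y j ω) (ξ k) μ) (B : Finset X) :
    ∫⁻ ω, (⨅ (k : ℕ) (_ : 1 ≤ k) (_ : Y k ω ∈ B), (k : ℝ≥0∞)) ∂μ
      = ∑' n, (tabooOp (recursionKernel Φ ν) B)^[n] 1 x := by
  simp_rw [fun ω => iInf_hitting_eq_tsum_prod B (fun k => Y k ω)]
  rw [lintegral_tsum]
  · refine tsum_congr fun n => ?_
    rw [← lintegral_prod_indicator_mul hY hξ hν hzero hrec hind B n 1]
    simp
  · exact fun n => (Finset.measurable_prod _ fun j _ =>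
      (Measurable.of_discrete (f := (B : Set X)ᶜ.indicator (1 : X → ℝ≥0∞))).comp
        (hY j)).aemeasurable

end RandomRecursion

/-! ### The queue as a recursion over cycles -/

namespace CTRModel

section Deterministic

variable {ι σ Kw : Type*} [Fintype ι] [Fintype σ]

/-- The number of impressions that client `i` gets in a time slot with outcome `o` when the queue
lengths are `x`. -/
def slotImpressions (sel : Kw → (ι → ℕ) → Matrix ι σ ℕ) (x : ι → ℕ) (i : ι) (o : Option Kw) : ℕ :=
  o.elim 0 fun κ => ∑ s, sel κ x i s

variable (A : CTRModel ι σ Kw) (sel : Kw → (ι → ℕ) → Matrix ι σ ℕ)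

/-- The queue update in a cycle with query outcomes `e.1` and requirements `e.2`. -/
def cycleStep (x : ι → ℕ) (e : (Fin A.N → Option Kw) × (ι → ℕ)) : ι → ℕ :=
  fun i => x i + e.2 i - ∑ j, slotImpressions sel x i (e.1 j)

lemma impressions_eq_sum (q : ℕ → Option Kw) (k : ℕ) (x : ι → ℕ) (i : ι) :
    A.impressions sel q k x i = ∑ j : Fin A.N, slotImpressions sel x i (q (k * A.N + j)) := by
  rw [impressions, Finset.sum_Ico_eq_sum_range, Nat.add_sub_cancel_left, Finset.sum_range]
  refine Finset.sum_congr rfl fun j _ => ?_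
  cases q (k * A.N + j) <;> rfl

lemma queue_succ_eq_cycleStep (q : ℕ → Option Kw) (mt : ℕ → ι → ℕ) (x : ι → ℕ) (k : ℕ) :
    A.queue sel q mt x (k + 1)
      = A.cycleStep sel (A.queue sel q mt x k) (fun j => q (k * A.N + j), mt k) := by
  funext i
  simp only [queue, cycleStep, impressions_eq_sum]

/-- Adaptedness: the queue at the start of cycle `k` sees only slots before `k * A.N` and
requirements before `k`. -/
lemma queue_congr {q q' : ℕ → Option Kw} {mt mt' : ℕ → ι → ℕ} (x : ι → ℕ) {k : ℕ}
    (hq : ∀ t < k * A.N, q t = q' t) (hmt : ∀ j < k, mt j = mt' j) :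
    A.queue sel q mt x k = A.queue sel q' mt' x k := by
  induction k with
  | zero => rfl
  | succ k ih =>
    have hlt : ∀ j : Fin A.N, k * A.N + j < (k + 1) * A.N := fun j => by
      rw [Nat.succ_mul]; exact Nat.add_lt_add_left j.2 _
    rw [queue_succ_eq_cycleStep, queue_succ_eq_cycleStep,
      ih (fun t ht => hq t (ht.trans_le (Nat.mul_le_mul_right _ k.le_succ)))
        (fun j hj => hmt j (hj.trans k.lt_succ_self)), hmt k k.lt_succ_self]
    simp only [hq _ (hlt _)]

lemma slotImpressions_le_one {sel : Kw → (ι → ℕ) → Matrix ι σ ℕ} (hsel : A.IsMaxWeightRule sel)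
    (x : ι → ℕ) (i : ι) (o : Option Kw) : slotImpressions sel x i o ≤ 1 := by
  cases o with
  | none => exact zero_le_one
  | some κ => exact (A.admissible_isAssignment κ _ (hsel κ x).1).2.2 i

lemma sum_slotImpressions_le {sel : Kw → (ι → ℕ) → Matrix ι σ ℕ} (hsel : A.IsMaxWeightRule sel)
    (x : ι → ℕ) (i : ι) (u : Fin A.N → Option Kw) :
    ∑ j, slotImpressions sel x i (u j) ≤ A.N :=
  (Finset.sum_le_sum fun j _ => A.slotImpressions_le_one hsel x i (u j)).trans (by simp)

end Deterministic

/-! ### Independence and stationarity of the cycle noise -/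

section Noise

variable {ι σ Kw Ω : Type*} [Fintype ι] [Fintype σ] [MeasurableSpace Ω]
  {A : CTRModel ι σ Kw} {μ : Measure Ω} {q : ℕ → Ω → Option Kw} {mt : ℕ → Ω → ι → ℕ}

/-- The query outcomes and the requirements of cycle `k`. -/
def cycleNoise (A : CTRModel ι σ Kw) (q : ℕ → Ω → Option Kw) (mt : ℕ → Ω → ι → ℕ) (k : ℕ) (ω : Ω) :
    (Fin A.N → Option Kw) × (ι → ℕ) :=
  (fun j => q (k * A.N + j) ω, mt k ω)

/-- The query outcomes and the requirements before cycle `k`. -/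
def pastNoise (A : CTRModel ι σ Kw) (q : ℕ → Ω → Option Kw) (mt : ℕ → Ω → ι → ℕ) (k : ℕ) (ω : Ω) :
    (Finset.range (k * A.N) → Option Kw) × (Finset.range k → ι → ℕ) :=
  (fun t => q t ω, fun j => mt j ω)

lemma IsInput.measurable_cycleNoise (hin : A.IsInput μ q mt) (k : ℕ) :
    Measurable (A.cycleNoise q mt k) :=
  (measurable_pi_lambda _ fun _ => hin.measurable_q _).prodMk (hin.measurable_mt k)

lemma IsInput.measurable_pastNoise (hin : A.IsInput μ q mt) (k : ℕ) :
    Measurable (A.pastNoise q mt k) :=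
  (measurable_pi_lambda _ fun _ => hin.measurable_q _).prodMk
    (measurable_pi_lambda _ fun _ => hin.measurable_mt _)

lemma IsInput.map_q_eq [Countable Kw] (hin : A.IsInput μ q mt) (t : ℕ) :
    μ.map (q t) = μ.map (q 0) := by
  refine Measure.ext_of_singleton fun o => ?_
  rw [Measure.map_apply (hin.measurable_q _) (measurableSet_singleton _),
    Measure.map_apply (hin.measurable_q _) (measurableSet_singleton _)]
  cases o with
  | none => exact (hin.prob_none t).trans (hin.prob_none 0).symm
  | some κ => exact (hin.prob_some t κ).trans (hin.prob_some 0 κ).symm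

variable [IsProbabilityMeasure μ]

lemma IsInput.indepFun_past_cycle (hin : A.IsInput μ q mt) (k : ℕ) :
    IndepFun (A.pastNoise q mt k) (A.cycleNoise q mt k) μ := by
  have hq := hin.indep_q.indepFun_finset (Finset.range (k * A.N))
    (Finset.Ico (k * A.N) (k * A.N + A.N)) (by
      rw [Finset.disjoint_left]
      intro t ht ht'
      simp only [Finset.mem_range, Finset.mem_Ico] at ht ht'
      omega) hin.measurable_q
  have hm := hin.indep_mt.indepFun_finset (Finset.range k) {k} (by simp) hin.measurable_mt
  refine IndepFun.prodMk_prodMk (measurable_pi_lambda _ fun _ => hin.measurable_q _)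
    (measurable_pi_lambda _ fun _ => hin.measurable_q _)
    (measurable_pi_lambda _ fun _ => hin.measurable_mt _) (hin.measurable_mt k)
    (hq.comp measurable_id
      (ψ := fun (u : Finset.Ico (k * A.N) (k * A.N + A.N) → Option Kw) (j : Fin A.N) =>
        u ⟨k * A.N + j, Finset.mem_Ico.2 ⟨Nat.le_add_right _ _, Nat.add_lt_add_left j.2 _⟩⟩) ?_)
    (hm.comp measurable_id
      (ψ := fun (u : ({k} : Finset ℕ) → ι → ℕ) => u ⟨k, Finset.mem_singleton_self k⟩)
      (measurable_pi_apply _)) ?_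
  · exact measurable_pi_lambda _ fun j => measurable_pi_apply _
  · exact hin.indep_q_mt.comp
      (φ := fun (u : ℕ → Option Kw) => ((fun (t : Finset.range (k * A.N)) => u t),
        (fun (j : Fin A.N) => u (k * A.N + j))))
      (ψ := fun (u : ℕ → ι → ℕ) => ((fun (t : Finset.range k) => u t), u k))
      ((measurable_pi_lambda _ fun _ => measurable_pi_apply _).prodMk
        (measurable_pi_lambda _ fun _ => measurable_pi_apply _))
      ((measurable_pi_lambda _ fun _ => measurable_pi_apply _).prodMk (measurable_pi_apply _))

lemma IsInput.indepFun_initial_past_cycle (hin : A.IsInput μ q mt) {Q₀ : Ω → ι → ℕ}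
    (hQ₀ : Measurable Q₀)
    (hind : IndepFun Q₀ (fun ω => ((fun t => q t ω), (fun k => mt k ω))) μ) (k : ℕ) :
    IndepFun (fun ω => (A.pastNoise q mt k ω, Q₀ ω)) (A.cycleNoise q mt k) μ := by
  -- The regrouping lemma with a constant as fourth variable adjoins the initial state to the past.
  have h := IndepFun.prodMk_prodMk (hin.measurable_pastNoise k) (hin.measurable_cycleNoise k) hQ₀
    (measurable_const (a := ())) (hin.indepFun_past_cycle k) (indepFun_const_right _ _)
    (hind.symm.comp
      (φ := fun (u : (ℕ → Option Kw) × (ℕ → ι → ℕ)) =>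
        (((fun (t : Finset.range (k * A.N)) => u.1 t), (fun (t : Finset.range k) => u.2 t)),
          ((fun (j : Fin A.N) => u.1 (k * A.N + j)), u.2 k)))
      (ψ := fun x => (x, ())) (by fun_prop) (by fun_prop))
  exact h.comp measurable_id measurable_fst

variable [Countable Kw]

lemma IsInput.map_cycleNoise_eq (hin : A.IsInput μ q mt) (k : ℕ) :
    μ.map (A.cycleNoise q mt k) = μ.map (A.cycleNoise q mt 0) := by
  have hprod : ∀ k, μ.map (A.cycleNoise q mt k)
      = (Measure.pi fun _ : Fin A.N => μ.map (q 0)).prod (μ.map (mt 0)) := by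
    intro k
    have hblock : Measurable fun ω (j : Fin A.N) => q (k * A.N + j) ω :=
      measurable_pi_lambda _ fun _ => hin.measurable_q _
    have hind : IndepFun (fun ω (j : Fin A.N) => q (k * A.N + j) ω) (mt k) μ :=
      hin.indep_q_mt.comp
        (φ := fun (u : ℕ → Option Kw) (j : Fin A.N) => u (k * A.N + j))
        (ψ := fun (u : ℕ → ι → ℕ) => u k) (by fun_prop) (by fun_prop)
    have hiind : iIndepFun (fun (j : Fin A.N) => q (k * A.N + j)) μ :=
      hin.indep_q.precomp fun a b h => Fin.ext (by simpa using h)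
    have h1 := hind.map_prod_eq_prod_map_map hblock.aemeasurable
      (hin.measurable_mt k).aemeasurable
    have h2 := (iIndepFun_iff_map_fun_eq_pi_map fun j =>
      (hin.measurable_q (k * A.N + (j : Fin A.N))).aemeasurable).1 hiind
    simp only [hin.map_q_eq] at h2
    rw [h2, (hin.identDistrib_mt k).map_eq] at h1
    exact h1
  rw [hprod, hprod]

end Noise

/-! ### Queues as functions of past inputs -/

section CreditQueue

variable {ι σ Kw Ω : Type*} [Fintype ι] [Fintype σ] {A : CTRModel ι σ Kw}
  {q : ℕ → Ω → Option Kw} {mt : ℕ → Ω → ι → ℕ}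

/-- The process of credit queues started from `Q₀`. -/
def creditQueue (A : CTRModel ι σ Kw) (sel : Kw → (ι → ℕ) → Matrix ι σ ℕ)
    (q : ℕ → Ω → Option Kw) (mt : ℕ → Ω → ι → ℕ) (Q₀ : Ω → ι → ℕ) (k : ℕ) (ω : Ω) : ι → ℕ :=
  A.queue sel (fun t => q t ω) (fun j => mt j ω) (Q₀ ω) k

/-- A single `H` serves all `j ≤ k`, so the whole path up to `k` is a function of the past. Unseen
inputs are filled with `none` and `0`, harmlessly by `queue_congr`. -/
lemma creditQueue_eq_past (sel : Kw → (ι → ℕ) → Matrix ι σ ℕ) (Q₀ : Ω → ι → ℕ) (k : ℕ) :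
    ∃ H : ((Finset.range (k * A.N) → Option Kw) × (Finset.range k → ι → ℕ)) × (ι → ℕ) →
        ℕ → ι → ℕ,
      ∀ j ≤ k, ∀ ω, A.creditQueue sel q mt Q₀ j ω = H (A.pastNoise q mt k ω, Q₀ ω) j := by
  classical
  refine ⟨fun p j => A.queue sel
    (fun t => if h : t ∈ Finset.range (k * A.N) then p.1.1 ⟨t, h⟩ else none)
    (fun t => if h : t ∈ Finset.range k then p.1.2 ⟨t, h⟩ else 0) p.2 j, fun j hj ω => ?_⟩
  refine A.queue_congr sel _ (fun t ht => ?_) fun t ht => ?_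
  · rw [dif_pos (Finset.mem_range.2 (ht.trans_le (Nat.mul_le_mul_right _ hj)))]; rfl
  · rw [dif_pos (Finset.mem_range.2 (ht.trans_le hj))]; rfl

lemma creditQueue_succ (sel : Kw → (ι → ℕ) → Matrix ι σ ℕ) (Q₀ : Ω → ι → ℕ) (k : ℕ) (ω : Ω) :
    A.creditQueue sel q mt Q₀ (k + 1) ω
      = A.cycleStep sel (A.creditQueue sel q mt Q₀ k ω) (A.cycleNoise q mt k ω) :=
  A.queue_succ_eq_cycleStep sel _ _ _ k

variable [Countable Kw] [MeasurableSpace Ω] {μ : Measure Ω}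
  {sel : Kw → (ι → ℕ) → Matrix ι σ ℕ} {Q₀ : Ω → ι → ℕ}

lemma IsInput.measurable_creditQueue (hin : A.IsInput μ q mt) (hQ₀ : Measurable Q₀) (k : ℕ) :
    Measurable (A.creditQueue sel q mt Q₀ k) := by
  obtain ⟨H, hH⟩ := A.creditQueue_eq_past (q := q) (mt := mt) sel Q₀ k
  rw [funext (hH k le_rfl)]
  exact (Measurable.of_discrete (f := fun p => H p k)).comp
    ((hin.measurable_pastNoise k).prodMk hQ₀)

end CreditQueue

/-! ### The Markov chain of credit queues -/

section Chain

variable {ι σ Kw Ω : Type*} [Fintype ι] [Fintype σ] [Countable Kw] [MeasurableSpace Ω]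
  {A : CTRModel ι σ Kw} {μ : Measure Ω} [IsProbabilityMeasure μ]
  {q : ℕ → Ω → Option Kw} {mt : ℕ → Ω → ι → ℕ}

/-- The transition kernel of the credit queues. -/
noncomputable def queueKernel (A : CTRModel ι σ Kw) (sel : Kw → (ι → ℕ) → Matrix ι σ ℕ)
    (μ : Measure Ω) (q : ℕ → Ω → Option Kw) (mt : ℕ → Ω → ι → ℕ) : Kernel (ι → ℕ) (ι → ℕ) :=
  recursionKernel (A.cycleStep sel) (μ.map (A.cycleNoise q mt 0))

lemma IsInput.isMarkovKernel (hin : A.IsInput μ q mt) (sel : Kw → (ι → ℕ) → Matrix ι σ ℕ) :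
    IsMarkovKernel (A.queueKernel sel μ q mt) := by
  have := Measure.isProbabilityMeasure_map (μ := μ) (hin.measurable_cycleNoise 0).aemeasurable
  unfold queueKernel
  infer_instance

variable {sel : Kw → (ι → ℕ) → Matrix ι σ ℕ} {Q₀ : Ω → ι → ℕ}

lemma IsInput.indepFun_path (hin : A.IsInput μ q mt) (hQ₀ : Measurable Q₀)
    (hind : IndepFun Q₀ (fun ω => ((fun t => q t ω), (fun k => mt k ω))) μ) (k : ℕ) :
    IndepFun (fun ω (j : Finset.range (k + 1)) => A.creditQueue sel q mt Q₀ j ω)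
      (A.cycleNoise q mt k) μ := by
  obtain ⟨H, hH⟩ := A.creditQueue_eq_past (q := q) (mt := mt) sel Q₀ k
  have h := (hin.indepFun_initial_past_cycle hQ₀ hind k).comp
    (φ := fun p (j : Finset.range (k + 1)) => H p j) Measurable.of_discrete measurable_id
  have hpath : (fun ω (j : Finset.range (k + 1)) => A.creditQueue sel q mt Q₀ j ω)
      = fun ω (j : Finset.range (k + 1)) => H (A.pastNoise q mt k ω, Q₀ ω) j := by
    funext ω j
    exact hH j (Nat.lt_succ_iff.1 (Finset.mem_range.1 j.2)) ω
  rw [hpath]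
  exact h

lemma IsInput.indepFun_creditQueue (hin : A.IsInput μ q mt) (hQ₀ : Measurable Q₀)
    (hind : IndepFun Q₀ (fun ω => ((fun t => q t ω), (fun k => mt k ω))) μ) (k : ℕ) :
    IndepFun (A.creditQueue sel q mt Q₀ k) (A.cycleNoise q mt k) μ :=
  (hin.indepFun_path (sel := sel) hQ₀ hind k).comp
    (φ := fun (p : Finset.range (k + 1) → ι → ℕ) => p ⟨k, Finset.self_mem_range_succ k⟩)
    (measurable_pi_apply _) measurable_id

lemma IsInput.map_creditQueue_succ (hin : A.IsInput μ q mt) (hQ₀ : Measurable Q₀)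
    (hind : IndepFun Q₀ (fun ω => ((fun t => q t ω), (fun k => mt k ω))) μ) (k : ℕ) :
    μ.map (A.creditQueue sel q mt Q₀ (k + 1))
      = (μ.map (A.creditQueue sel q mt Q₀ k)).bind (A.queueKernel sel μ q mt) :=
  map_succ_eq_bind (hin.measurable_creditQueue hQ₀) hin.measurable_cycleNoise
    hin.map_cycleNoise_eq (creditQueue_succ sel _) (hin.indepFun_creditQueue hQ₀ hind) k

/-- Removes the sample paths from stability: Foster's criterion can prove the right side, and the
tightness theorem can use it with a random initial state. -/
lemma IsInput.stable_iff (hin : A.IsInput μ q mt) :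
    A.Stable μ sel q mt ↔
      ∃ B : Finset (ι → ℕ), ∀ x, ∑' n, (tabooOp (A.queueKernel sel μ q mt) B)^[n] 1 x ≠ ∞ := by
  refine exists_congr fun B => forall_congr' fun x => ?_
  rw [← lt_top_iff_ne_top, queueKernel,
    ← lintegral_hitting_eq_tsum (Y := A.creditQueue sel q mt fun _ => x)
    (hin.measurable_creditQueue measurable_const) hin.measurable_cycleNoise hin.map_cycleNoise_eq
    (fun _ => rfl) (creditQueue_succ sel _)
    (hin.indepFun_path measurable_const (indepFun_const_left _ _)) B]
  rfl

end Chain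

end CTRModel

/-! ### Near-optimality of the maximum weight rule -/

namespace CTRModel

variable {ι σ Kw : Type*} [Fintype ι] [Fintype σ]

section MaxWeight

variable (A : CTRModel ι σ Kw)

lemma rate_nonneg (κ : Kw) : 0 ≤ A.rate κ := mul_nonneg A.arrival_pos.le (A.θ_nonneg κ)

lemma hasSum_rate : HasSum A.rate A.arrival := by
  have h := A.θ_hasSum.mul_left A.arrival
  rwa [mul_one] at h

lemma summable_rate_mul {g : Kw → ℝ} (h0 : ∀ κ, 0 ≤ g κ) (h1 : ∀ κ, g κ ≤ 1) :
    Summable fun κ => A.rate κ * g κ :=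
  Summable.of_nonneg_of_le (fun κ => mul_nonneg (A.rate_nonneg κ) (h0 κ))
    (fun κ => mul_le_of_le_one_right (A.rate_nonneg κ) (h1 κ)) A.hasSum_rate.summable

lemma row_sum_le_one {κ : Kw} {M : Matrix ι σ ℕ} (hM : M ∈ A.admissible κ) (i : ι) :
    ∑ s, (M i s : ℝ) ≤ 1 := by
  exact_mod_cast (A.admissible_isAssignment κ M hM).2.2 i

lemma sum_mul_row_sum_le_weight (κ : Kw) (x : ι → ℕ) (M : Matrix ι σ ℕ) :
    ∑ i, (x i : ℝ) * ∑ s, (M i s : ℝ) ≤ A.weight κ x M := by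
  refine Finset.sum_le_sum fun i _ => ?_
  rw [Finset.mul_sum]
  refine Finset.sum_le_sum fun s _ => ?_
  rw [mul_comm]
  exact mul_le_mul_of_nonneg_left
    (le_add_of_nonneg_left (div_nonneg (A.c_nonneg κ i s) A.ε_pos.le)) (Nat.cast_nonneg _)

lemma weight_le {κ : Kw} (x : ι → ℕ) {M : Matrix ι σ ℕ} (hM : M ∈ A.admissible κ) :
    A.weight κ x M ≤ ∑ i, (x i : ℝ) * ∑ s, (M i s : ℝ) + Fintype.card ι / A.ε := by
  have h : (Fintype.card ι : ℝ) / A.ε = ∑ _i : ι, 1 / A.ε := by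
    rw [Finset.sum_const, Finset.card_univ, nsmul_eq_mul, mul_one_div]
  rw [h, ← Finset.sum_add_distrib]
  refine Finset.sum_le_sum fun i _ => ?_
  have h1 : ∑ s, (M i s : ℝ) * (A.c κ i s / A.ε) ≤ 1 / A.ε := by
    calc ∑ s, (M i s : ℝ) * (A.c κ i s / A.ε) ≤ ∑ s, (M i s : ℝ) * (1 / A.ε) := by
          refine Finset.sum_le_sum fun s _ => mul_le_mul_of_nonneg_left ?_ (Nat.cast_nonneg _)
          exact div_le_div_of_nonneg_right (A.c_le_one κ i s) A.ε_pos.le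
      _ = (∑ s, (M i s : ℝ)) * (1 / A.ε) := by rw [Finset.sum_mul]
      _ ≤ 1 / A.ε := mul_le_of_le_one_left (one_div_nonneg.2 A.ε_pos.le) (A.row_sum_le_one hM i)
  calc ∑ s, (M i s : ℝ) * (A.c κ i s / A.ε + x i)
      = ∑ s, (M i s : ℝ) * (A.c κ i s / A.ε) + x i * ∑ s, (M i s : ℝ) := by
        rw [Finset.mul_sum, ← Finset.sum_add_distrib]
        exact Finset.sum_congr rfl fun s _ => by ring
    _ ≤ _ := by linarith

variable {A} {p : Kw → Matrix ι σ ℕ → ℝ} {sel : Kw → (ι → ℕ) → Matrix ι σ ℕ}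

/-- The maximal weight dominates every average of admissible weights. It is nonnegative, which
covers total mass below `1`; passing between weights and queue-weighted impressions costs at most
`card ι / ε`, as each client gets at most one slot. -/
lemma StrictlyFeasible.sum_mul_le (hp : A.StrictlyFeasible p) (hsel : A.IsMaxWeightRule sel)
    (κ : Kw) (x : ι → ℕ) :
    ∑ i, (x i : ℝ) * ∑ M ∈ A.admissible κ, p κ M * ∑ s, (M i s : ℝ)
      ≤ ∑ i, (x i : ℝ) * ∑ s, (sel κ x i s : ℝ) + Fintype.card ι / A.ε := by
  have hnn : 0 ≤ A.weight κ x (sel κ x) :=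
    (Finset.sum_nonneg fun i _ => by positivity).trans (A.sum_mul_row_sum_le_weight κ x _)
  calc ∑ i, (x i : ℝ) * ∑ M ∈ A.admissible κ, p κ M * ∑ s, (M i s : ℝ)
      = ∑ M ∈ A.admissible κ, p κ M * ∑ i, (x i : ℝ) * ∑ s, (M i s : ℝ) := by
        simp_rw [Finset.mul_sum (A.admissible κ)]
        rw [Finset.sum_comm]
        refine Finset.sum_congr rfl fun M _ => ?_
        rw [Finset.mul_sum]
        exact Finset.sum_congr rfl fun i _ => by ring
    _ ≤ ∑ M ∈ A.admissible κ, p κ M * A.weight κ x (sel κ x) :=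
        Finset.sum_le_sum fun M hM => mul_le_mul_of_nonneg_left
          ((A.sum_mul_row_sum_le_weight κ x M).trans ((hsel κ x).2 M hM)) (hp.1 κ M hM).1
    _ = (∑ M ∈ A.admissible κ, p κ M) * A.weight κ x (sel κ x) := by rw [Finset.sum_mul]
    _ ≤ A.weight κ x (sel κ x) := mul_le_of_le_one_left hnn (hp.2.1 κ)
    _ ≤ _ := A.weight_le x (hsel κ x).1

/-- The expected number of impressions of client `i` in a cycle in which the queue lengths
are `x`. -/
noncomputable def meanImpressions (A : CTRModel ι σ Kw) (sel : Kw → (ι → ℕ) → Matrix ι σ ℕ)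
    (x : ι → ℕ) (i : ι) : ℝ :=
  A.N * ∑' κ, A.rate κ * ∑ s, (sel κ x i s : ℝ)

/-- Among all feasible choices, the maximum weight rule almost maximizes the queue-weighted
impressions. -/
lemma StrictlyFeasible.sum_mul_avgImpressions_le (hp : A.StrictlyFeasible p)
    (hsel : A.IsMaxWeightRule sel) (x : ι → ℕ) :
    ∑ i, (x i : ℝ) * A.avgImpressions p i ≤ ∑ i, (x i : ℝ) * A.meanImpressions sel x i
      + A.N * (A.arrival * (Fintype.card ι / A.ε)) := by
  set a : ι → Kw → ℝ := fun i κ => ∑ M ∈ A.admissible κ, p κ M * ∑ s, (M i s : ℝ) with ha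
  set b : ι → Kw → ℝ := fun i κ => ∑ s, (sel κ x i s : ℝ) with hb
  have hsa : ∀ i, Summable fun κ => A.rate κ * a i κ := fun i =>
    A.summable_rate_mul
      (fun κ => Finset.sum_nonneg fun M hM => mul_nonneg (hp.1 κ M hM).1 (by positivity))
      (fun κ => (Finset.sum_le_sum fun M hM => mul_le_of_le_one_right (hp.1 κ M hM).1
        (A.row_sum_le_one hM i)).trans (hp.2.1 κ))
  have hsb : ∀ i, Summable fun κ => A.rate κ * b i κ := fun i =>
    A.summable_rate_mul (fun κ => by positivity) (fun κ => A.row_sum_le_one (hsel κ x).1 i)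
  have h1 : HasSum (fun κ => ∑ i, (x i : ℝ) * (A.rate κ * a i κ))
      (∑ i, (x i : ℝ) * ∑' κ, A.rate κ * a i κ) :=
    hasSum_sum fun i _ => (hsa i).hasSum.mul_left _
  have h2 : HasSum (fun κ => ∑ i, (x i : ℝ) * (A.rate κ * b i κ)
        + A.rate κ * (Fintype.card ι / A.ε))
      (∑ i, (x i : ℝ) * (∑' κ, A.rate κ * b i κ) + A.arrival * (Fintype.card ι / A.ε)) :=
    (hasSum_sum fun i _ => (hsb i).hasSum.mul_left _).add (A.hasSum_rate.mul_right _)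
  have h3 := hasSum_le (fun κ => ?_) h1 h2
  · have h4 := mul_le_mul_of_nonneg_left h3 (Nat.cast_nonneg (α := ℝ) A.N)
    rw [mul_add, Finset.mul_sum, Finset.mul_sum] at h4
    simp only [avgImpressions, meanImpressions]
    simpa only [mul_left_comm (A.N : ℝ)] using h4
  · have h5 := mul_le_mul_of_nonneg_left (hp.sum_mul_le hsel κ x) (A.rate_nonneg κ)
    rw [mul_add, Finset.mul_sum, Finset.mul_sum] at h5
    simpa only [mul_left_comm (A.rate κ)] using h5

end MaxWeight

/-! ### Moments of requirements and impressions -/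

section Moments

variable {Ω : Type*} [MeasurableSpace Ω] {A : CTRModel ι σ Kw} {μ : Measure Ω}
  {q : ℕ → Ω → Option Kw} {mt : ℕ → Ω → ι → ℕ}

lemma IsInput.ae_mt_le (hin : A.IsInput μ q mt) (k : ℕ) (i : ι) :
    ∀ᵐ ω ∂μ, mt k ω i ≤ ⌈A.m i⌉₊ := by
  have hm : Measurable fun ω => mt k ω i := (measurable_pi_apply i).comp (hin.measurable_mt k)
  have hdirac : ∀ a b : ℕ, a ≤ b → ∀ᵐ n ∂(Measure.dirac a), n ≤ b := fun a b hab => by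
    rw [ae_dirac_eq]
    exact eventually_pure.2 hab
  have h : ∀ᵐ n ∂(μ.map fun ω => mt k ω i), n ≤ ⌈A.m i⌉₊ := by
    rw [hin.law_mt, ae_add_measure_iff]
    exact ⟨Measure.ae_smul_measure (hdirac _ _ le_rfl) _,
      Measure.ae_smul_measure (hdirac _ _ (Nat.floor_le_ceil _)) _⟩
  exact ae_of_ae_map hm.aemeasurable h

lemma IsInput.integral_mt (hin : A.IsInput μ q mt) (k : ℕ) (i : ι) :
    ∫ ω, (mt k ω i : ℝ) ∂μ = A.m i := by
  have hm : Measurable fun ω => mt k ω i := (measurable_pi_apply i).comp (hin.measurable_mt k)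
  have h0 : (⌊A.m i⌋₊ : ℝ) ≤ A.m i := Nat.floor_le (A.m_nonneg i)
  have h1 : A.m i < ⌊A.m i⌋₊ + 1 := Nat.lt_floor_add_one _
  rw [← integral_map (φ := fun ω => mt k ω i) (f := fun n : ℕ => (n : ℝ)) hm.aemeasurable
    Measurable.of_discrete.aestronglyMeasurable, hin.law_mt,
    integral_add_measure ((integrable_dirac (by simp)).smul_measure ENNReal.ofReal_ne_top)
      ((integrable_dirac (by simp)).smul_measure ENNReal.ofReal_ne_top),
    integral_smul_measure, integral_smul_measure, integral_dirac, integral_dirac,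
    ENNReal.toReal_ofReal (by linarith), ENNReal.toReal_ofReal (by linarith), smul_eq_mul,
    smul_eq_mul]
  -- For an integer requirement the upper atom has weight zero; otherwise the ceiling is the floor
  -- plus one.
  rcases h0.eq_or_lt with h | h
  · rw [← h]; simp
  · have hc : ⌈A.m i⌉₊ = ⌊A.m i⌋₊ + 1 := by
      rw [Nat.ceil_eq_iff (Nat.succ_ne_zero _)]
      exact ⟨by simpa using h, by push_cast; exact h1.le⟩
    rw [hc]
    push_cast
    ring

variable [IsProbabilityMeasure μ]

lemma IsInput.integrable_mt (hin : A.IsInput μ q mt) (k : ℕ) (i : ι) :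
    Integrable (fun ω => (mt k ω i : ℝ)) μ := by
  refine Integrable.of_bound (C := (⌈A.m i⌉₊ : ℝ)) ?_ ?_
  · exact (Measurable.of_discrete.comp
      ((measurable_pi_apply i).comp (hin.measurable_mt k))).aestronglyMeasurable
  · filter_upwards [hin.ae_mt_le k i] with ω hω
    rw [Real.norm_natCast]
    exact_mod_cast hω

lemma IsInput.integrable_slotImpressions (hin : A.IsInput μ q mt)
    {sel : Kw → (ι → ℕ) → Matrix ι σ ℕ} (hsel : A.IsMaxWeightRule sel) (x : ι → ℕ) (i : ι)
    (t : ℕ) : Integrable (fun ω => (slotImpressions sel x i (q t ω) : ℝ)) μ :=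
  Integrable.of_bound (C := 1)
    ((Measurable.of_discrete (f := fun o => (slotImpressions sel x i o : ℝ))).comp
      (hin.measurable_q t)).aestronglyMeasurable
    (ae_of_all _ fun ω => by
      rw [Real.norm_natCast]; exact_mod_cast A.slotImpressions_le_one hsel x i _)

variable [Countable Kw]

lemma IsInput.integral_slotImpressions (hin : A.IsInput μ q mt)
    {sel : Kw → (ι → ℕ) → Matrix ι σ ℕ} (hsel : A.IsMaxWeightRule sel) (x : ι → ℕ) (i : ι)
    (t : ℕ) :
    ∫ ω, (slotImpressions sel x i (q t ω) : ℝ) ∂μ = ∑' κ, A.rate κ * ∑ s, (sel κ x i s : ℝ) := by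
  have := Measure.isProbabilityMeasure_map (μ := μ) (hin.measurable_q t).aemeasurable
  rw [← integral_map (φ := q t) (f := fun o => (slotImpressions sel x i o : ℝ))
    (hin.measurable_q t).aemeasurable Measurable.of_discrete.aestronglyMeasurable,
    integral_countable]
  · rw [← (Option.some_injective Kw).tsum_eq]
    · refine tsum_congr fun κ => ?_
      rw [map_measureReal_apply (hin.measurable_q t) (measurableSet_singleton _), smul_eq_mul]
      congr 1
      · rw [measureReal_def]
        exact (congrArg ENNReal.toReal (hin.prob_some t κ)).trans
          (ENNReal.toReal_ofReal (A.rate_nonneg κ))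
      · simp [slotImpressions]
    · intro o ho
      cases o with
      | none => simp [slotImpressions] at ho
      | some κ => exact ⟨κ, rfl⟩
  · exact integrable_of_abs_le _ (M := 1) fun o => by
      rw [Nat.abs_cast]; exact_mod_cast A.slotImpressions_le_one hsel x i o

lemma IsInput.integral_sum_slotImpressions (hin : A.IsInput μ q mt)
    {sel : Kw → (ι → ℕ) → Matrix ι σ ℕ} (hsel : A.IsMaxWeightRule sel) (x : ι → ℕ) (i : ι)
    (k : ℕ) :
    ∫ ω, ∑ j : Fin A.N, (slotImpressions sel x i (q (k * A.N + j) ω) : ℝ) ∂μ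
      = A.meanImpressions sel x i := by
  rw [integral_finsetSum _ fun j _ => hin.integrable_slotImpressions hsel x i _]
  simp_rw [hin.integral_slotImpressions hsel]
  simp [meanImpressions]

end Moments

end CTRModel

namespace CTRModel

variable {ι σ Kw Ω : Type*} [Fintype ι] [Fintype σ] {A : CTRModel ι σ Kw}
  {q : ℕ → Ω → Option Kw} {mt : ℕ → Ω → ι → ℕ} {sel : Kw → (ι → ℕ) → Matrix ι σ ℕ}

lemma cycleImpressions_eq_sum {Q₀ : Ω → ι → ℕ} (k : ℕ) (i : ι) (ω : Ω) :
    A.cycleImpressions sel q mt Q₀ k i ω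
      = ∑ j, slotImpressions sel (A.creditQueue sel q mt Q₀ k ω) i
          ((A.cycleNoise q mt k ω).1 j) :=
  A.impressions_eq_sum sel _ k _ i

lemma cycleImpressions_le (hsel : A.IsMaxWeightRule sel) {Q₀ : Ω → ι → ℕ} (k : ℕ) (i : ι) (ω : Ω) :
    A.cycleImpressions sel q mt Q₀ k i ω ≤ A.N := by
  rw [cycleImpressions_eq_sum]
  exact A.sum_slotImpressions_le hsel _ i _

variable [Countable Kw] [MeasurableSpace Ω] {μ : Measure Ω} [IsProbabilityMeasure μ]

/-! ### Quadratic drift and stability -/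

section Drift

/-- Truncation at `0` only decreases the square of `x + m - s`; expanding it leaves `(m - s) ^ 2`,
where `|m - s| ≤ D + N`. -/
lemma sq_tsub_le (x m s D N : ℕ) (hm : m ≤ D) (hs : s ≤ N) :
    (((x + m - s : ℕ) : ℝ)) ^ 2
      ≤ (x : ℝ) ^ 2 + 2 * x * ((m : ℝ) - s) + ((D : ℝ) + N) ^ 2 := by
  have hm' : (m : ℝ) ≤ D := by exact_mod_cast hm
  have hs' : (s : ℝ) ≤ N := by exact_mod_cast hs
  have h0 : (0 : ℝ) ≤ m := Nat.cast_nonneg _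
  have h1 : (0 : ℝ) ≤ s := Nat.cast_nonneg _
  have hsq : ((m : ℝ) - s) ^ 2 ≤ ((D : ℝ) + N) ^ 2 := sq_le_sq' (by linarith) (by linarith)
  rcases le_total s (x + m) with h | h
  · rw [Nat.cast_sub h]
    push_cast
    nlinarith
  · rw [Nat.sub_eq_zero_of_le h]
    push_cast
    nlinarith [sq_nonneg ((x : ℝ) + m - s)]

/-- The quadratic Lyapunov function. -/
noncomputable def lyapunov (x : ι → ℕ) : ℝ≥0∞ := ENNReal.ofReal (∑ i, (x i : ℝ) ^ 2)

/-- The constant term in the drift of the Lyapunov function. -/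
noncomputable def driftConst (A : CTRModel ι σ Kw) : ℝ := ∑ i, ((⌈A.m i⌉₊ : ℝ) + A.N) ^ 2

/-- Here `r` is the mean of the pointwise majorant `R`. Its nonnegativity allows the later
computation to pass between real numbers and `ℝ≥0∞`. -/
lemma IsInput.lintegral_lyapunov_le (hin : A.IsInput μ q mt) (hsel : A.IsMaxWeightRule sel)
    (x : ι → ℕ) :
    ∃ r : ℝ, 0 ≤ r ∧ ∫⁻ y, lyapunov y ∂A.queueKernel sel μ q mt x ≤ ENNReal.ofReal r ∧
      r = ∑ i, (x i : ℝ) ^ 2 + 2 * ∑ i, (x i : ℝ) * (A.m i - A.meanImpressions sel x i)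
        + A.driftConst := by
  set S : ι → Ω → ℝ := fun i ω =>
    ∑ j : Fin A.N, (slotImpressions sel x i (q (0 * A.N + j) ω) : ℝ) with hS
  set R : Ω → ℝ := fun ω => ∑ i, ((x i : ℝ) ^ 2 + 2 * x i * ((mt 0 ω i : ℝ) - S i ω)
    + ((⌈A.m i⌉₊ : ℝ) + A.N) ^ 2) with hR
  have hSint : ∀ i, Integrable (S i) μ := fun i =>
    integrable_finsetSum _ fun j _ => hin.integrable_slotImpressions hsel x i _
  have hterm : ∀ i, Integrable (fun ω => 2 * x i * ((mt 0 ω i : ℝ) - S i ω)) μ := fun i =>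
    ((hin.integrable_mt 0 i).sub (hSint i)).const_mul _
  have hterm' : ∀ i, Integrable (fun ω => (x i : ℝ) ^ 2 + 2 * x i * ((mt 0 ω i : ℝ) - S i ω)) μ :=
    fun i => (integrable_const _).add (hterm i)
  have hterm'' : ∀ i, Integrable (fun ω => (x i : ℝ) ^ 2 + 2 * x i * ((mt 0 ω i : ℝ) - S i ω)
      + ((⌈A.m i⌉₊ : ℝ) + A.N) ^ 2) μ := fun i => (hterm' i).add (integrable_const _)
  have hRint : Integrable R μ := integrable_finsetSum _ fun i _ => hterm'' i
  have hle : ∀ᵐ ω ∂μ, ∑ i, (A.cycleStep sel x (A.cycleNoise q mt 0 ω) i : ℝ) ^ 2 ≤ R ω := by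
    have hall : ∀ᵐ ω ∂μ, ∀ i, mt 0 ω i ≤ ⌈A.m i⌉₊ := ae_all_iff.2 fun i => hin.ae_mt_le 0 i
    filter_upwards [hall] with ω hω
    refine Finset.sum_le_sum fun i _ => ?_
    have h := sq_tsub_le (x i) (mt 0 ω i) _ _ _ (hω i)
      (A.sum_slotImpressions_le hsel x i fun j => q (0 * A.N + j) ω)
    simp only [Nat.cast_sum] at h
    exact h
  have hR0 : 0 ≤ᵐ[μ] R := by
    filter_upwards [hle] with ω hω
    exact (Finset.sum_nonneg fun i _ => sq_nonneg _).trans hω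
  refine ⟨∫ ω, R ω ∂μ, integral_nonneg_of_ae hR0, ?_, ?_⟩
  · rw [queueKernel, lintegral_recursionKernel,
      lintegral_map Measurable.of_discrete (hin.measurable_cycleNoise 0),
      ofReal_integral_eq_lintegral_ofReal hRint hR0]
    refine lintegral_mono_ae ?_
    filter_upwards [hle] with ω hω
    exact ENNReal.ofReal_le_ofReal hω
  · have hi : ∀ i, ∫ ω, ((x i : ℝ) ^ 2 + 2 * x i * ((mt 0 ω i : ℝ) - S i ω)
        + ((⌈A.m i⌉₊ : ℝ) + A.N) ^ 2) ∂μ = (x i : ℝ) ^ 2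
          + 2 * x i * (A.m i - A.meanImpressions sel x i) + ((⌈A.m i⌉₊ : ℝ) + A.N) ^ 2 := by
      intro i
      rw [integral_add (hterm' i) (integrable_const _),
        integral_add (integrable_const _) (hterm i), integral_const_mul,
        integral_sub (hin.integrable_mt 0 i) (hSint i), hin.integral_mt,
        hin.integral_sum_slotImpressions hsel]
      simp
    rw [hR, integral_finsetSum _ fun i _ => hterm'' i, Finset.sum_congr rfl fun i _ => hi i,
      Finset.sum_add_distrib, Finset.sum_add_distrib, driftConst, Finset.mul_sum]
    simp only [mul_assoc]

theorem IsInput.stable_of_strictlyFeasible (hin : A.IsInput μ q mt)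
    (hsel : A.IsMaxWeightRule sel) {p : Kw → Matrix ι σ ℕ → ℝ} (hp : A.StrictlyFeasible p) :
    A.Stable μ sel q mt := by
  classical
  have := hin.isMarkovKernel sel
  rw [hin.stable_iff]
  -- The drift constant, twice the loss of the maximum weight rule, and the decrease `1` that
  -- Foster's criterion demands. Outside the box below, one coordinate alone contributes at least
  -- `C` to the negative drift.
  set C : ℝ := A.driftConst + 2 * (A.N * (A.arrival * (Fintype.card ι / A.ε))) + 1 with hC
  have hgap : ∀ i, 0 < A.avgImpressions p i - A.m i := fun i => sub_pos.2 (hp.2.2 i)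
  refine ⟨Fintype.piFinset fun i =>
    Finset.Iic ⌈C / (2 * (A.avgImpressions p i - A.m i))⌉₊, ?_⟩
  refine tsum_tabooOp_iterate_ne_top _ (V := lyapunov) (fun x => ?_) fun x hx => ?_
  · obtain ⟨r, -, hr, -⟩ := hin.lintegral_lyapunov_le hsel x
    exact ne_top_of_le_ne_top ENNReal.ofReal_ne_top hr
  · obtain ⟨r, hr0, hr, hreq⟩ := hin.lintegral_lyapunov_le hsel x
    simp only [Fintype.mem_piFinset, Finset.mem_Iic, not_forall, not_le] at hx
    obtain ⟨i, hi⟩ := hx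
    have hdrift : C ≤ 2 * ∑ i, (x i : ℝ) * (A.avgImpressions p i - A.m i) := by
      have h1 : C ≤ x i * (2 * (A.avgImpressions p i - A.m i)) := by
        rw [← div_le_iff₀ (by linarith [hgap i])]
        exact (Nat.le_ceil _).trans (by exact_mod_cast hi.le)
      have h2 : (x i : ℝ) * (A.avgImpressions p i - A.m i)
          ≤ ∑ i, (x i : ℝ) * (A.avgImpressions p i - A.m i) :=
        Finset.single_le_sum (f := fun i => (x i : ℝ) * (A.avgImpressions p i - A.m i))
          (fun j _ => mul_nonneg (Nat.cast_nonneg _) (hgap j).le) (Finset.mem_univ i)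
      linarith
    have hmw := hp.sum_mul_avgImpressions_le hsel x
    have hrle : r + 1 ≤ ∑ i, (x i : ℝ) ^ 2 := by
      simp only [mul_sub, Finset.sum_sub_distrib] at hreq hdrift
      linarith
    calc _ ≤ ENNReal.ofReal r + 1 := add_le_add hr le_rfl
      _ = ENNReal.ofReal (r + 1) := by rw [ENNReal.ofReal_add hr0 zero_le_one, ENNReal.ofReal_one]
      _ ≤ lyapunov x := ENNReal.ofReal_le_ofReal hrle

end Drift

/-! ### Long-run impressions of a stable system -/

section Throughput

variable {Q₀ : Ω → ι → ℕ}

/-- If `p` fails, the cap `R` is inactive before and after the step, and truncation at `0` can only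
raise the increment above `m - s`. If `p` holds, the capped queue falls by at most `s`, which the
penalty `D + N` covers. -/
lemma sub_sub_indicator_le_min_sub_min {y m s D N R : ℕ} {p : Prop} [Decidable p] (hm : m ≤ D)
    (hs : s ≤ N) (hp : ¬ p → y + D ≤ R) :
    (m : ℝ) - s - (D + N) * (if p then 1 else 0)
      ≤ (min (y + m - s) R : ℕ) - (min y R : ℕ) := by
  by_cases h : p
  · have h1 : min y R + m ≤ min (y + m - s) R + s + D + N := by omega
    have h2 : ((min y R : ℕ) : ℝ) + m ≤ (min (y + m - s) R : ℕ) + s + D + N := by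
      exact_mod_cast h1
    rw [if_pos h]
    linarith
  · have h0 := hp h
    have h1 : min y R + m ≤ min (y + m - s) R + s := by omega
    have h2 : ((min y R : ℕ) : ℝ) + m ≤ (min (y + m - s) R : ℕ) + s := by exact_mod_cast h1
    rw [if_neg h]
    linarith

lemma IsInput.integrable_cycleImpressions (hin : A.IsInput μ q mt) (hsel : A.IsMaxWeightRule sel)
    (hQ₀ : Measurable Q₀) (k : ℕ) (i : ι) :
    Integrable (fun ω => (A.cycleImpressions sel q mt Q₀ k i ω : ℝ)) μ := by
  refine Integrable.of_bound (C := A.N) ?_ (ae_of_all _ fun ω => ?_)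
  · simp_rw [cycleImpressions_eq_sum]
    exact ((Measurable.of_discrete
      (f := fun p : (ι → ℕ) × ((Fin A.N → Option Kw) × (ι → ℕ)) =>
        ((∑ j, slotImpressions sel p.1 i (p.2.1 j) : ℕ) : ℝ))).comp
      ((hin.measurable_creditQueue hQ₀ k).prodMk
        (hin.measurable_cycleNoise k))).aestronglyMeasurable
  · rw [Real.norm_natCast]
    exact_mod_cast cycleImpressions_le hsel k i ω

lemma IsInput.exists_finset_creditQueue_compl_le (hin : A.IsInput μ q mt)
    (hstab : A.Stable μ sel q mt) (hQ₀ : Measurable Q₀)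
    (hind : IndepFun Q₀ (fun ω => ((fun t => q t ω), (fun k => mt k ω))) μ) {η : ℝ} (hη : 0 < η) :
    ∃ F : Finset (ι → ℕ), ∀ k,
      (μ.map (A.creditQueue sel q mt Q₀ k)).real (F : Set (ι → ℕ))ᶜ ≤ η := by
  have := hin.isMarkovKernel sel
  have := fun k => Measure.isProbabilityMeasure_map (μ := μ)
    (hin.measurable_creditQueue (sel := sel) hQ₀ k).aemeasurable
  obtain ⟨B, hB⟩ := hin.stable_iff.1 hstab
  exact exists_finset_law_compl_le (A.queueKernel sel μ q mt) hB
    (fun k => μ.map (A.creditQueue sel q mt Q₀ k)) (hin.map_creditQueue_succ hQ₀ hind) hη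

/-- In a stable system the expected average numbers of impressions converge. -/
theorem IsInput.exists_tendsto_average_impressions (hin : A.IsInput μ q mt)
    (hsel : A.IsMaxWeightRule sel) (hstab : A.Stable μ sel q mt) (hQ₀ : Measurable Q₀)
    (hind : IndepFun Q₀ (fun ω => ((fun t => q t ω), (fun k => mt k ω))) μ) (i : ι) :
    ∃ l, Tendsto (fun K : ℕ => (∑ k ∈ Finset.range K,
      ∫ ω, (A.cycleImpressions sel q mt Q₀ (k + 1) i ω : ℝ) ∂μ) / K) atTop (𝓝 l) := by
  have := hin.isMarkovKernel sel
  have := fun k => Measure.isProbabilityMeasure_map (μ := μ)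
    (hin.measurable_creditQueue (sel := sel) hQ₀ k).aemeasurable
  have := Measure.isProbabilityMeasure_map (μ := μ) (hin.measurable_cycleNoise 0).aemeasurable
  -- The mean number of impressions given the queue `x`; independence of queue and current noise
  -- makes expected impressions integrals of this bounded function.
  set f : (ι → ℕ) → ℝ := fun x => ∫ e, ((∑ j, slotImpressions sel x i (e.1 j) : ℕ) : ℝ)
    ∂(μ.map (A.cycleNoise q mt 0)) with hf
  have hbd : ∀ (x : ι → ℕ) (u : Fin A.N → Option Kw),
      |((∑ j, slotImpressions sel x i (u j) : ℕ) : ℝ)| ≤ A.N := fun x u => by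
    rw [Nat.abs_cast]
    exact_mod_cast A.sum_slotImpressions_le hsel x i u
  have hE : ∀ k, ∫ ω, (A.cycleImpressions sel q mt Q₀ k i ω : ℝ) ∂μ
      = ∫ x, f x ∂(μ.map (A.creditQueue sel q mt Q₀ k)) := by
    intro k
    simp_rw [cycleImpressions_eq_sum]
    rw [(hin.indepFun_creditQueue hQ₀ hind k).integral_eq (hin.measurable_creditQueue hQ₀ k)
      (hin.measurable_cycleNoise k)
      (G := fun p : (ι → ℕ) × ((Fin A.N → Option Kw) × (ι → ℕ)) =>
        ((∑ j, slotImpressions sel p.1 i (p.2.1 j) : ℕ) : ℝ)) Measurable.of_discrete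
      (fun z => hbd z.1 z.2.1), hin.map_cycleNoise_eq k]
  simp_rw [hE]
  refine exists_tendsto_average_integral (A.queueKernel sel μ q mt)
    (fun k => μ.map (A.creditQueue sel q mt Q₀ (k + 1)))
    (fun k => hin.map_creditQueue_succ hQ₀ hind (k + 1)) (fun η hη => ?_) (f := f) (M := A.N)
    fun x => abs_integral_le_of_abs_le _ fun e => hbd x e.1
  obtain ⟨F, hF⟩ := hin.exists_finset_creditQueue_compl_le hstab hQ₀ hind hη
  exact ⟨F, fun k => hF (k + 1)⟩

/-- In a stable system the expected average number of impressions in the first `K` cycles is not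
much smaller than the requirement. -/
lemma IsInput.exists_le_average_impressions (hin : A.IsInput μ q mt)
    (hsel : A.IsMaxWeightRule sel) (hstab : A.Stable μ sel q mt) (hQ₀ : Measurable Q₀)
    (hind : IndepFun Q₀ (fun ω => ((fun t => q t ω), (fun k => mt k ω))) μ) (i : ι) {η : ℝ}
    (hη : 0 < η) :
    ∃ R : ℝ, ∀ K : ℕ, 0 < K → A.m i - (⌈A.m i⌉₊ + A.N) * η - R / K
      ≤ (∑ k ∈ Finset.range K,
          ∫ ω, (A.cycleImpressions sel q mt Q₀ (k + 1) i ω : ℝ) ∂μ) / K := by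
  classical
  obtain ⟨F, hF⟩ := hin.exists_finset_creditQueue_compl_le hstab hQ₀ hind hη
  set Y := A.creditQueue sel q mt Q₀ with hY
  set D := ⌈A.m i⌉₊
  -- From a state in `F`, adding a full requirement `D` stays below the cap.
  set R : ℕ := F.sup (fun x => x i) + D
  set a : ℕ → ℝ := fun k => ∫ ω, ((min (Y k ω i) R : ℕ) : ℝ) ∂μ with ha
  have hYm : ∀ k, Measurable (Y k) := hin.measurable_creditQueue hQ₀
  have hmin : ∀ k, Integrable (fun ω => ((min (Y k ω i) R : ℕ) : ℝ)) μ := fun k =>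
    Integrable.of_bound (C := R) ((Measurable.of_discrete
      (f := fun x : ι → ℕ => ((min (x i) R : ℕ) : ℝ))).comp (hYm k)).aestronglyMeasurable
      (ae_of_all _ fun ω => by rw [Real.norm_natCast]; exact_mod_cast min_le_right _ _)
  have ha0 : ∀ k, 0 ≤ a k := fun k => integral_nonneg fun ω => Nat.cast_nonneg _
  have haR : ∀ k, a k ≤ R := fun k => by
    calc a k ≤ ∫ _ω, (R : ℝ) ∂μ := integral_mono (hmin k) (integrable_const _) fun ω =>
          Nat.cast_le.2 (min_le_right _ _)
      _ = R := by simp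
  have hmeas : ∀ k, MeasurableSet {ω | Y k ω ∉ F} := fun k =>
    hYm k (MeasurableSet.of_discrete (s := (F : Set (ι → ℕ))ᶜ))
  have hfun : ∀ k, (fun ω => if Y k ω ∉ F then (1 : ℝ) else 0)
      = {ω | Y k ω ∉ F}.indicator 1 := fun k => by
    funext ω
    simp only [Set.indicator_apply, Set.mem_ofPred_eq, Pi.one_apply]
  have hindint : ∀ k, Integrable (fun ω => if Y k ω ∉ F then (1 : ℝ) else 0) μ := fun k => by
    rw [hfun]
    exact (integrable_const (1 : ℝ)).indicator (hmeas k)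
  have hindle : ∀ k, ∫ ω, (if Y k ω ∉ F then (1 : ℝ) else 0) ∂μ ≤ η := by
    intro k
    have h1 : ∫ ω, (if Y k ω ∉ F then (1 : ℝ) else 0) ∂μ = μ.real {ω | Y k ω ∉ F} := by
      rw [hfun, integral_indicator_one (hmeas k)]
    have h2 := hF k
    rw [map_measureReal_apply (hYm k) MeasurableSet.of_discrete] at h2
    rw [h1]
    exact h2
  have hstep : ∀ k, A.m i - ∫ ω, (A.cycleImpressions sel q mt Q₀ k i ω : ℝ) ∂μ
      - (D + A.N) * η ≤ a (k + 1) - a k := by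
    intro k
    have hpt : ∀ᵐ ω ∂μ, (mt k ω i : ℝ) - A.cycleImpressions sel q mt Q₀ k i ω
        - (D + A.N) * (if Y k ω ∉ F then 1 else 0)
        ≤ (min (Y (k + 1) ω i) R : ℕ) - (min (Y k ω i) R : ℕ) := by
      filter_upwards [hin.ae_mt_le k i] with ω hω
      exact sub_sub_indicator_le_min_sub_min hω (cycleImpressions_le hsel k i ω) fun hp =>
        Nat.add_le_add_right
          (Finset.le_sup (f := fun x : ι → ℕ => x i) (not_not.1 hp)) D
    have hSi := hin.integrable_cycleImpressions hsel hQ₀ k i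
    have hdiff : Integrable
        (fun ω => (mt k ω i : ℝ) - A.cycleImpressions sel q mt Q₀ k i ω) μ :=
      (hin.integrable_mt k i).sub hSi
    have h := integral_mono_ae (hdiff.sub ((hindint k).const_mul _))
      ((hmin (k + 1)).sub (hmin k)) hpt
    simp only [Pi.sub_apply] at h
    rw [integral_sub hdiff ((hindint k).const_mul _),
      integral_sub (hin.integrable_mt k i) hSi, integral_const_mul, hin.integral_mt,
      integral_sub (hmin (k + 1)) (hmin k)] at h
    refine le_trans ?_ h
    have := mul_le_mul_of_nonneg_left (hindle k)
      (add_nonneg (Nat.cast_nonneg D) (Nat.cast_nonneg A.N) : (0 : ℝ) ≤ D + A.N)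
    linarith
  refine ⟨R, fun K hK => ?_⟩
  have hKr : (0 : ℝ) < K := by exact_mod_cast hK
  -- The capped means telescope to `a (K + 1) - a 1`, at most `R`, which vanishes after division by
  -- `K`.
  have hsum := Finset.sum_le_sum fun k (_ : k ∈ Finset.range K) => hstep (k + 1)
  rw [Finset.sum_range_sub (fun k => a (k + 1)), Finset.sum_sub_distrib, Finset.sum_sub_distrib,
    Finset.sum_const, Finset.sum_const, Finset.card_range, nsmul_eq_mul, nsmul_eq_mul] at hsum
  rw [le_div_iff₀ hKr, sub_mul, div_mul_cancel₀ _ hKr.ne']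
  have h1 := haR (K + 1)
  have h2 := ha0 (0 + 1)
  linarith

end Throughput

end CTRModel

/-! ### The main theorem -/

theorem mainTheorem7 {ι σ Kw Ω : Type*} [Fintype ι] [Fintype σ] [Countable Kw] [MeasurableSpace Ω]
    (μ : Measure Ω) [IsProbabilityMeasure μ] (A : CTRModel ι σ Kw)
    (sel : Kw → (ι → ℕ) → Matrix ι σ ℕ) (hsel : A.IsMaxWeightRule sel)
    (q : ℕ → Ω → Option Kw) (mt : ℕ → Ω → ι → ℕ) (hin : A.IsInput μ q mt) :
    ((∃ p, A.StrictlyFeasible p) → A.Stable μ sel q mt) ∧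
    (A.Stable μ sel q mt →
      ∀ Q₀ : Ω → ι → ℕ, Measurable Q₀ →
        IndepFun Q₀ (fun ω => ((fun t => q t ω), (fun k => mt k ω))) μ →
        ∀ i, ∃ l : ℝ,
          Tendsto (fun K : ℕ => ∫ ω, (1 / (K : ℝ)) *
            ∑ k ∈ Finset.Icc 1 K, (A.cycleImpressions sel q mt Q₀ k i ω : ℝ) ∂μ) atTop (𝓝 l) ∧
          A.m i ≤ l) := by
  refine ⟨fun ⟨p, hp⟩ => hin.stable_of_strictlyFeasible hsel hp,
    fun hstab Q₀ hQ₀ hind i => ?_⟩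
  have hav : ∀ K : ℕ, ∫ ω, (1 / (K : ℝ)) *
      ∑ k ∈ Finset.Icc 1 K, (A.cycleImpressions sel q mt Q₀ k i ω : ℝ) ∂μ
      = (∑ k ∈ Finset.range K,
          ∫ ω, (A.cycleImpressions sel q mt Q₀ (k + 1) i ω : ℝ) ∂μ) / K := by
    intro K
    rw [integral_const_mul,
      integral_finsetSum _ fun k _ => hin.integrable_cycleImpressions hsel hQ₀ k i,
      ← Finset.Ico_add_one_right_eq_Icc, Finset.sum_Ico_eq_sum_range, one_div_mul_eq_div]
    simp only [Nat.add_sub_cancel, add_comm 1]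
  obtain ⟨l, hl⟩ := hin.exists_tendsto_average_impressions hsel hstab hQ₀ hind i
  refine ⟨l, by simpa only [hav] using hl, ?_⟩
  have hC : (0 : ℝ) < ⌈A.m i⌉₊ + A.N := by
    have : (0 : ℝ) < A.N := by exact_mod_cast A.N_pos
    positivity
  refine le_of_forall_pos_sub_le fun δ hδ => ?_
  -- The tail mass is chosen so that its total cost `(⌈A.m i⌉₊ + A.N) * η` is exactly `δ`.
  obtain ⟨R, hR⟩ := hin.exists_le_average_impressions hsel hstab hQ₀ hind i (div_pos hδ hC)
  rw [mul_div_cancel₀ _ hC.ne'] at hR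
  have hlim : Tendsto (fun K : ℕ => A.m i - δ - R / K) atTop (𝓝 (A.m i - δ)) := by
    simpa using (tendsto_const_div_atTop_nhds_zero_nat R).const_sub (A.m i - δ)
  refine le_of_tendsto_of_tendsto hlim hl ?_
  filter_upwards [eventually_gt_atTop 0] with K hK using hR K hK
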